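/- Let $\gamma=\mathrm{conv}(A_0,\dots,A_7)$ be a (closed) regular octagon in the plane, vertices numbered counterclockwise. The outer billiard map $T$ sends $p\notin\gamma$ to the point symmetric to $p$ with respect to the point of tangency of the right tangent from $p$ to $\gamma$ (the one having $\gamma$ on its left as seen from $p$); $T(p)$ is undefined if this tangent contains a side of $\gamma$. A point $p$ is *periodic* if $T^np=p$ for some $n\ge 1$, and *aperiodic* if it is not periodic and its trajectory $(T^np)_{n\in\mathbb Z}$ is infinite in both directions. Let $R$ be the intersection of the lines $A_1A_2$ and $A_3A_4$, let $O=A_1$, and let $K,L,M$ be the points symmetric to $A_4,A_3,A_2$ with respect to $R$. Let $T'$ be the partial map of the open quadrilateral $\mathrm{int}(OKLM)$ induced by $T$ after identifying points under rotations by multiples of $\pi/4$ about the centre of $\gamma$. A *renormalization* of $T'$ is a similarity $g$ of the plane with ratio in $(0,1)$ such that $g(OKLM)\subseteq OKLM$ and such that, $T''$ being the first return map of $T'$ to $\mathrm{int}\,g(OKLM)$, for every $x\in\mathrm{int}(OKLM)$: $T'(x)$ is defined if and only if $T''(g(x))$ is, and then $g(T'(x))=T''(g(x))$. **Theorem.**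 For every regular octagon $\gamma$ the outer billiard map outside $\gamma$ has an aperiodic point. More precisely, there are a renormalization $g$ of $T'$ and a point $c$ such that the quadrilaterals $G_0=g(OKLM)$, $G_{i+1}=g(G_i)$ are nested, their intersection is $\{c\}$, every sequence of points $x_i\in G_i$ converges to $c$, and $c$ is an aperiodic point of $T$. -/

import Mathlib

open Set Filter Topology

/-! ### Iteration, periodicity and first return for partially defined maps -/

/-- The `n`-th iterate of a partial map `f` at `x`; it is undefined as soon as one step is. -/
def iterPart {α : Type*} (f : α →. α) (n : ℕ) (x : α) : Part α :=
  (fun o : Part α => o.bind f)^[n] (Part.some x)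

/-- `p` is periodic: `f^n p = p` for some positive integer `n`. -/
def IsPeriodicPoint {α : Type*} (f : α →. α) (p : α) : Prop :=
  ∃ n : ℕ, 0 < n ∧ p ∈ iterPart f n p

/-- `p` has a two-sided infinite trajectory `…, x (-1), x 0 = p, x 1, …`. -/
def HasTwoSidedOrbit {α : Type*} (f : α →. α) (p : α) : Prop :=
  ∃ x : ℤ → α, x 0 = p ∧ ∀ n : ℤ, x (n + 1) ∈ f (x n)

/-- `p` is aperiodic: it is not periodic and its trajectory is infinite in both directions. -/
def IsAperiodicPoint {α : Type*} (f : α →. α) (p : α) : Prop :=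
  ¬ IsPeriodicPoint f p ∧ HasTwoSidedOrbit f p

open Classical in
/-- The first return map of `f` to `S`: it sends `x` to `f^n x`, where `n` is the least positive
integer such that `f^n x` is defined and lies in `S`; it is undefined if there is no such `n`. -/
noncomputable def firstReturn {α : Type*} (f : α →. α) (S : Set α) : α →. α := fun x =>
  ⟨∃ n : ℕ, 0 < n ∧ ∃ h : (iterPart f n x).Dom, (iterPart f n x).get h ∈ S,
    fun h => (iterPart f (Nat.find h) x).get (Nat.find_spec h).2.choose⟩

/-! ### The outer billiard map; the plane is `ℂ` -/

/-- The cross product of two plane vectors. -/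
def crossProd (u v : ℂ) : ℝ := u.re * v.im - u.im * v.re

/-- `q` is a point of tangency of the right tangent from `p` to `γ`: looking from `p` along the
ray `pq`, the figure `γ` lies (weakly) to the left. -/
def IsRightTangentPoint (γ : Set ℂ) (p q : ℂ) : Prop :=
  q ∈ γ ∧ ∀ x ∈ γ, 0 ≤ crossProd (q - p) (x - p)

/-- The outer billiard map outside `γ`: a point `p ∉ γ` is reflected in the point of tangency of
the right tangent from `p`. It is undefined when that tangent touches `γ` in several points. -/
noncomputable def outerBilliard (γ : Set ℂ) : ℂ →. ℂ := fun p =>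
  ⟨p ∉ γ ∧ ∃! q, IsRightTangentPoint γ p q, fun h => Equiv.pointReflection h.2.choose p⟩

/-! ### The regular octagon and the reduced map -/

/-- The rotation by `π / 4`, as a complex number. -/
noncomputable def rot8 : ℂ := Complex.exp ((Real.pi / 4 : ℝ) * Complex.I)

/-- The vertices `A_0, …, A_7` (counterclockwise) of the regular octagon with centre `z` and
vertex `A_0 = z + a`. -/
noncomputable def octVertex (z a : ℂ) (k : ℕ) : ℂ := z + a * rot8 ^ k

/-- The closed regular octagon with centre `z` and vertex `z + a`. -/
noncomputable def octagon (z a : ℂ) : Set ℂ := convexHull ℝ (range (octVertex z a))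

/-- The intersection point `R` of the lines `A_1 A_2` and `A_3 A_4`: the triangle `A_2 R A_3` is
isosceles with a right angle at `R`, so `R` lies beyond `A_2` at distance `A_1 A_2 / √2`. -/
noncomputable def dartR (z a : ℂ) : ℂ :=
  octVertex z a 2 + (octVertex z a 2 - octVertex z a 1) / (Real.sqrt 2 : ℝ)

/-- The vertex `O = A_1`. -/
noncomputable def dartO (z a : ℂ) : ℂ := octVertex z a 1

/-- The vertex `K`, symmetric to `A_4` with respect to `R`. -/
noncomputable def dartK (z a : ℂ) : ℂ := Equiv.pointReflection (dartR z a) (octVertex z a 4)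

/-- The vertex `L`, symmetric to `A_3` with respect to `R`. -/
noncomputable def dartL (z a : ℂ) : ℂ := Equiv.pointReflection (dartR z a) (octVertex z a 3)

/-- The vertex `M`, symmetric to `A_2` with respect to `R`. -/
noncomputable def dartM (z a : ℂ) : ℂ := Equiv.pointReflection (dartR z a) (octVertex z a 2)

/-- The closed quadrilateral `OKLM`. It is not convex (its angle at `L` is `5π/4`); the point `R`
lies on the side `OM` and on the extension of the side `KL` beyond `L`, and the segment `RL` cuts
`OKLM` into the triangles `OKR` and `RLM`. -/
noncomputable def dart (z a : ℂ) : Set ℂ :=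
  convexHull ℝ {dartO z a, dartK z a, dartR z a} ∪ convexHull ℝ {dartR z a, dartL z a, dartM z a}

/-- The reduced map `T'` on the open quadrilateral `OKLM`, induced by the outer billiard `T` after
points are identified under rotations by multiples of `π / 4` about the centre of the octagon:
`T' x` is the point of the open quadrilateral that is identified with `T x`. -/
noncomputable def reducedMap (z a : ℂ) : ℂ →. ℂ := fun x =>
  ⟨x ∈ interior (dart z a) ∧ ∃! y, y ∈ interior (dart z a) ∧
      ∃ w ∈ outerBilliard (octagon z a) x, ∃ k : ℕ, y = z + rot8 ^ k * (w - z),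
    fun h => h.2.choose⟩

/-- `g` is a renormalization (self-similarity) of the reduced map: it is a contracting similarity
which maps the quadrilateral `OKLM` into itself, and it conjugates `T'` to the first return map
of `T'` to the open quadrilateral `g(OKLM)`. The equality in `conj` says, for `x` in the open
quadrilateral `OKLM`, that one side is defined if and only if the other one is, and that they
then agree. -/
structure IsRenormalization (z a : ℂ) (g : ℂ →ᵃ[ℝ] ℂ) : Prop where
  contracting_similarity : ∃ r : ℝ, 0 < r ∧ r < 1 ∧ ∀ x y : ℂ, dist (g x) (g y) = r * dist x y
  image_subset : g '' dart z a ⊆ dart z a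
  conj : ∀ x ∈ interior (dart z a),
    (reducedMap z a x).map g =
      firstReturn (reducedMap z a) (interior (g '' dart z a)) (g x)

/-- The quadrilaterals `G_0 = g(OKLM)`, `G_{i+1} = g(G_i)`. -/
noncomputable def renormQuad (z a : ℂ) (g : ℂ →ᵃ[ℝ] ℂ) (i : ℕ) : Set ℂ :=
  g^[i + 1] '' dart z a

/-!
Up to rotations about the centre, the outer billiard map moves a point `p` of the open quadrilateral
`OKLM` to `2 A₁ - ζ ^ (9 - k) p`, where `ζ` is the rotation by `π / 4`, the octagon is centred at `0`,
and `A_k` is the point of tangency; only `k = 2, 3, 4` occur, and the three domains are the triangle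
`O X A₂`, the quadrilateral `X K R A₂` and the triangle `R L M`, with `X` on the line `A₂A₃`.

The renormalization `g` is the similarity with ratio `(√2 - 1)²` and rotation angle `3π/2` which
takes `O` to `L`. To see that it conjugates the reduced map `T'` to the first return map, cut the
quadrilateral into triangles on which `T'` is one branch and the two segments on which `T'` is
undefined. The image of each triangle under `g` follows one sequence of branches, stays away from
`g(OKLM)`, and arrives after 12, 9 or 6 steps at the image under `g` of its own image
(`conj_of_returnCheck`); the image of each segment reaches a segment where `T'` is undefined without
having returned (`conj_of_stopCheck`). In the oblique coordinates `x + y ζ` all vertices and all maps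
have coefficients in `ℤ[√2]`, so these statements amount to finitely many inequalities between
elements of `ℤ[√2]`, one for every vertex of a polygon and every line, which are decided by
computation. The same method describes the domains of the branches and shows that the rotated copies
of the quadrilateral are disjoint.

The limit point `c` of the nested quadrilaterals is the fixed point of `g`. It has an image `y ≠ c`
and a preimage `x ≠ c` under `T'`. The conjugacy turns orbits of `T'` into orbits
(`exists_iterPart_renormMap`), so that `g^i y` is on the forward orbit of `c = g^i c`, and `c` on that
of `g^i x`, for all `i`. These points are distinct, and the outer billiard map is injective
(`outerBilliard_injective`), so the trajectory of `c` is infinite in both directions and not periodic.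
-/

namespace OctagonBilliard

/-! ### Exact planar arithmetic over `ℤ[√2]` -/

/-- The rotation by `π / 4` in the oblique coordinates `(x, y) ↦ x + y ζ`, where `ζ = exp (iπ/4)`
and `s = √2`; it has this form since `ζ² = √2 ζ - 1`. -/
def rotate {R : Type*} [CommRing R] (s : R) (p : R × R) : R × R := (-p.2, p.1 + s * p.2)

/-- Twice the oriented area of the triangle `u v p`, in oblique coordinates: it is positive when `p`
lies to the left of the line `uv`. -/
def side {R : Type*} [CommRing R] (u v p : R × R) : R :=
  (v.1 - u.1) * (p.2 - u.2) - (v.2 - u.2) * (p.1 - u.1)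

/-- The branch `p ↦ 2 A₁ - ζ ^ (9 - k) p` of the reduced map, used where the tangent passes through
`A_k`. The unit of length is half of the circumradius, so that `A₁ = (0, 2)`. -/
def branch {R : Type*} [CommRing R] (s : R) (k : ℕ) (p : R × R) : R × R :=
  (-((rotate s)^[9 - k] p).1, 4 - ((rotate s)^[9 - k] p).2)

/-- The renormalization: the similarity with ratio `(√2 - 1)² = 3 - 2 √2` and angle `3π/2` which
takes `O` to `L`. -/
def renorm {R : Type*} [CommRing R] (s : R) (p : R × R) : R × R :=
  (-4 + (3 - 2 * s) * ((rotate s)^[6] (p.1, p.2 - 2)).1,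
    2 + 2 * s + (3 - 2 * s) * ((rotate s)^[6] (p.1, p.2 - 2)).2)

/-- A point with coordinates in `ℤ[√2]`. -/
abbrev Pt := ℤ√2 × ℤ√2

/-- A triangle, given by its vertices; a segment is encoded by repeating a vertex. -/
abbrev Tri := Pt × Pt × Pt

/-- The square root of two in `ℤ[√2]`. -/
def zs : ℤ√2 := ⟨0, 1⟩

/-- A sufficient test for `x` to be nonnegative as a real number. -/
def isNonneg (x : ℤ√2) : Bool :=
  (decide (0 ≤ x.re) && decide (0 ≤ x.im)) ||
  (decide (0 ≤ x.re) && decide (2 * (x.im * x.im) ≤ x.re * x.re)) ||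
  (decide (0 ≤ x.im) && decide (x.re * x.re ≤ 2 * (x.im * x.im)))

/-- A sufficient test for `x` to be positive as a real number. -/
def isPos (x : ℤ√2) : Bool :=
  (decide (0 ≤ x.re) && decide (0 ≤ x.im) && (decide (0 < x.re) || decide (0 < x.im))) ||
  (decide (0 ≤ x.re) && decide (2 * (x.im * x.im) < x.re * x.re)) ||
  (decide (0 ≤ x.im) && decide (x.re * x.re < 2 * (x.im * x.im)))

/-- Every vertex of `t` is weakly to the left of `uv`. -/
def nonnegOn (u v : Pt) (t : Tri) : Bool :=
  isNonneg (side u v t.1) && isNonneg (side u v t.2.1) && isNonneg (side u v t.2.2)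

/-- Every vertex of `t` is weakly to the left of `uv`, and some vertex strictly. -/
def posOn (u v : Pt) (t : Tri) : Bool :=
  nonnegOn u v t && (isPos (side u v t.1) || isPos (side u v t.2.1) || isPos (side u v t.2.2))

/-- Every vertex of `t` is strictly to the left of `uv`. -/
def allPosOn (u v : Pt) (t : Tri) : Bool :=
  isPos (side u v t.1) && isPos (side u v t.2.1) && isPos (side u v t.2.2)

/-- The image of a triangle under a map of points. -/
def Tri.map (f : Pt → Pt) (t : Tri) : Tri := (f t.1, f t.2.1, f t.2.2)

/-- The vertex `A_k` of the octagon. -/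
def vA (k : ℕ) : Pt := (rotate zs)^[k] (2, 0)

/-- The point `R`. -/
def vR : Pt := (⟨-2, -1⟩, ⟨2, 1⟩)
/-- The vertex `K`. -/
def vK : Pt := (2 * vR.1 - (vA 4).1, 2 * vR.2 - (vA 4).2)
/-- The vertex `L`. -/
def vL : Pt := (2 * vR.1 - (vA 3).1, 2 * vR.2 - (vA 3).2)
/-- The vertex `M`. -/
def vM : Pt := (2 * vR.1 - (vA 2).1, 2 * vR.2 - (vA 2).2)
/-- The intersection of the line `A₂A₃` with the side `OK`. -/
def vX : Pt := (⟨0, -1⟩, ⟨2, 1⟩)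

/-- A test for `t` to be contained in the open quadrilateral `OKLM`, see `dartInt`. -/
def insideDart (t : Tri) : Bool :=
  posOn (vA 1) vK t && posOn vM (vA 1) t && (posOn vK vR t || posOn vL vM t)

/-- A test for `t` to be disjoint from the image of the open quadrilateral `OKLM` under `f`. -/
def outsideDart (f : Pt → Pt) (t : Tri) : Bool :=
  nonnegOn (f vK) (f (vA 1)) t || nonnegOn (f (vA 1)) (f vM) t ||
    (nonnegOn (f vR) (f vK) t && nonnegOn (f vM) (f vL) t)

/-- A test for `u'v'` to be the line `uv` with the same orientation. -/
def sameLine (u v u' v' : Pt) : Bool :=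
  decide (side u v u' = 0) && decide (side u v v' = 0) &&
    isPos ((v.1 - u.1) * (v'.1 - u'.1) + (v.2 - u.2) * (v'.2 - u'.2))

/-- A test for the reduced map to be `branch k` on `t`: the right tangents from the points of `t`
touch the octagon in `A_k` only, and `t` and its image lie in the open quadrilateral. -/
def inPiece (k : ℕ) (t : Tri) : Bool :=
  (List.range 8).all (fun j => j == k || posOn (vA k) (vA j) t) &&
  insideDart t && insideDart (t.map (branch zs k))

/-- A test for the right tangents from the points of `t` to contain the side `A_k A_{k+1}`. -/
def onSingular (k : ℕ) (t : Tri) : Bool :=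
  (List.range 8).all (fun j => nonnegOn (vA k) (vA j) t && nonnegOn (vA (k + 1)) (vA j) t)

/-- A test for `t` to follow the branches listed in `l` without meeting the renormalized
quadrilateral at the intermediate times, and to end at `t'`. -/
def returnCheck : List ℕ → Tri → Tri → Bool
  | [], _, _ => false
  | [k], t, t' => inPiece k t && decide (t.map (branch zs k) = t')
  | k :: k' :: l, t, t' => inPiece k t && outsideDart (renorm zs) (t.map (branch zs k)) &&
      returnCheck (k' :: l) (t.map (branch zs k)) t'

/-- A test for `t` to follow the branches listed in `l` without meeting the renormalized
quadrilateral, and to end where the tangent contains the side `A_m A_{m+1}`. -/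
def stopCheck (m : ℕ) : List ℕ → Tri → Bool
  | [], t => onSingular m t
  | k :: l, t => inPiece k t && outsideDart (renorm zs) (t.map (branch zs k)) &&
      stopCheck m l (t.map (branch zs k))

/-- The domain `O X A₂` of the branch `2`. -/
def cellTwo : Tri := (vA 1, vX, vA 2)
/-- The part `X K R` of the domain `X K R A₂` of the branch `3`. -/
def cellThreeLeft : Tri := (vX, vK, vR)
/-- The part `X R A₂` of the domain `X K R A₂` of the branch `3`. -/
def cellThreeRight : Tri := (vX, vR, vA 2)
/-- The diagonal `X R` of the domain `X K R A₂` of the branch `3`. -/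
def cellThreeMid : Tri := (vX, vR, vR)
/-- The domain `R L M` of the branch `4`. -/
def cellFour : Tri := (vR, vL, vM)
/-- The segment `X A₂`, where the tangent contains the side `A₂A₃`. -/
def cellSegTwo : Tri := (vX, vA 2, vA 2)
/-- The segment `R L`, where the tangent contains the side `A₃A₄`. -/
def cellSegThree : Tri := (vR, vL, vL)

/-! ### Real values and barycentric coordinates -/

/-- The real value of an element of `ℤ[√2]`. -/
noncomputable def ev : ℤ√2 →+* ℝ :=
  Zsqrtd.lift ⟨√2, by norm_num⟩

theorem ev_apply (x : ℤ√2) : ev x = x.re + x.im * √2 := by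
  simp [ev]

@[simp] theorem ev_zs : ev zs = √2 := by simp [ev_apply, zs]

theorem sqrtTwo_sq : √2 * √2 = 2 := Real.mul_self_sqrt (by norm_num)

theorem ev_nonneg {x : ℤ√2} (h : isNonneg x = true) : 0 ≤ ev x := by
  have hs := sqrtTwo_sq
  have h0 : 0 ≤ √2 := Real.sqrt_nonneg 2
  rw [ev_apply]
  simp only [isNonneg, Bool.or_eq_true, Bool.and_eq_true, decide_eq_true_eq] at h
  rcases h with (⟨h1, h2⟩ | ⟨h1, h2⟩) | ⟨h1, h2⟩
  · have h1' : (0 : ℝ) ≤ x.re := by exact_mod_cast h1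
    have h2' : (0 : ℝ) ≤ x.im := by exact_mod_cast h2
    positivity
  · have h1' : (0 : ℝ) ≤ x.re := by exact_mod_cast h1
    have h2' : 2 * ((x.im : ℝ) * x.im) ≤ x.re * x.re := by exact_mod_cast h2
    have := abs_le_of_sq_le_sq' (a := x.im * √2) (b := (x.re : ℝ)) (by nlinarith) h1'
    linarith [this.1]
  · have h1' : (0 : ℝ) ≤ x.im := by exact_mod_cast h1
    have h2' : (x.re : ℝ) * x.re ≤ 2 * (x.im * x.im) := by exact_mod_cast h2
    have := abs_le_of_sq_le_sq' (a := (x.re : ℝ)) (b := x.im * √2) (by nlinarith) (by positivity)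
    linarith [this.1]

theorem ev_pos {x : ℤ√2} (h : isPos x = true) : 0 < ev x := by
  have hs := sqrtTwo_sq
  have h0 : 0 < √2 := by positivity
  rw [ev_apply]
  simp only [isPos, Bool.or_eq_true, Bool.and_eq_true, decide_eq_true_eq] at h
  rcases h with (⟨⟨h1, h2⟩, h3⟩ | ⟨h1, h2⟩) | ⟨h1, h2⟩
  · have h1' : (0 : ℝ) ≤ x.re := by exact_mod_cast h1
    have h2' : (0 : ℝ) ≤ x.im := by exact_mod_cast h2
    rcases h3 with h3 | h3
    · have h3' : (0 : ℝ) < x.re := by exact_mod_cast h3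
      positivity
    · have h3' : (0 : ℝ) < x.im := by exact_mod_cast h3
      positivity
  · have h1' : (0 : ℝ) ≤ x.re := by exact_mod_cast h1
    have h2' : 2 * ((x.im : ℝ) * x.im) < x.re * x.re := by exact_mod_cast h2
    have := abs_lt_of_sq_lt_sq' (a := x.im * √2) (b := (x.re : ℝ)) (by nlinarith) h1'
    linarith [this.1]
  · have h1' : (0 : ℝ) ≤ x.im := by exact_mod_cast h1
    have h2' : (x.re : ℝ) * x.re < 2 * (x.im * x.im) := by exact_mod_cast h2
    have := abs_lt_of_sq_lt_sq' (a := (x.re : ℝ)) (b := x.im * √2) (by nlinarith) (by positivity)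
    linarith [this.1]

/-- The real oblique coordinates of a point of `ℤ[√2]²`. -/
noncomputable def evPt (p : Pt) : ℝ × ℝ := (ev p.1, ev p.2)

theorem side_evPt (u v p : Pt) : side (evPt u) (evPt v) (evPt p) = ev (side u v p) := by
  simp [side, evPt]

theorem rotate_evPt (p : Pt) : rotate √2 (evPt p) = evPt (rotate zs p) := by
  simp [rotate, evPt]

theorem rotate_iterate_evPt (k : ℕ) (p : Pt) :
    (rotate √2)^[k] (evPt p) = evPt ((rotate zs)^[k] p) := by
  induction k generalizing p with
  | zero => rfl
  | succ n ih => rw [Function.iterate_succ_apply, Function.iterate_succ_apply, rotate_evPt, ih]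

/-- Nonnegative weights with sum one. -/
structure IsWeight (w : ℝ × ℝ × ℝ) : Prop where
  fst : 0 ≤ w.1
  snd : 0 ≤ w.2.1
  trd : 0 ≤ w.2.2
  sum : w.1 + w.2.1 + w.2.2 = 1

/-- Positive weights with sum one. -/
structure IsPosWeight (w : ℝ × ℝ × ℝ) : Prop where
  fst : 0 < w.1
  snd : 0 < w.2.1
  trd : 0 < w.2.2
  sum : w.1 + w.2.1 + w.2.2 = 1

theorem IsPosWeight.isWeight {w : ℝ × ℝ × ℝ} (h : IsPosWeight w) : IsWeight w :=
  ⟨h.fst.le, h.snd.le, h.trd.le, h.sum⟩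

/-- The point with barycentric coordinates `w` in the triangle `abc`. -/
def bary (w : ℝ × ℝ × ℝ) (a b c : ℝ × ℝ) : ℝ × ℝ :=
  (w.1 * a.1 + w.2.1 * b.1 + w.2.2 * c.1, w.1 * a.2 + w.2.1 * b.2 + w.2.2 * c.2)

/-- The point with barycentric coordinates `w` in the triangle `t`. -/
noncomputable def comb (w : ℝ × ℝ × ℝ) (t : Tri) : ℝ × ℝ :=
  bary w (evPt t.1) (evPt t.2.1) (evPt t.2.2)

theorem side_bary {w : ℝ × ℝ × ℝ} (hw : w.1 + w.2.1 + w.2.2 = 1) (u v a b c : ℝ × ℝ) :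
    side u v (bary w a b c) = w.1 * side u v a + w.2.1 * side u v b + w.2.2 * side u v c := by
  simp only [side, bary]
  linear_combination ((v.1 - u.1) * u.2 - (v.2 - u.2) * u.1) * hw

theorem side_comb {w : ℝ × ℝ × ℝ} (hw : w.1 + w.2.1 + w.2.2 = 1) (u v : Pt) (t : Tri) :
    side (evPt u) (evPt v) (comb w t) =
      w.1 * ev (side u v t.1) + w.2.1 * ev (side u v t.2.1) + w.2.2 * ev (side u v t.2.2) := by
  rw [comb, side_bary hw, side_evPt, side_evPt, side_evPt]

theorem side_swap {R : Type*} [CommRing R] (u v p : R × R) : side v u p = - side u v p := by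
  simp only [side]; ring

theorem side_rotate {R : Type*} [CommRing R] (u v p : R × R) : side v p u = side u v p := by
  simp only [side]; ring

theorem nonneg_of_nonnegOn {u v : Pt} {t : Tri} (h : nonnegOn u v t = true)
    {w : ℝ × ℝ × ℝ} (hw : IsWeight w) : 0 ≤ side (evPt u) (evPt v) (comb w t) := by
  simp only [nonnegOn, Bool.and_eq_true] at h
  obtain ⟨⟨h1, h2⟩, h3⟩ := h
  rw [side_comb hw.sum]
  have := mul_nonneg hw.fst (ev_nonneg h1)
  have := mul_nonneg hw.snd (ev_nonneg h2)
  have := mul_nonneg hw.trd (ev_nonneg h3)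
  positivity

/-- The inequality is strict at all points with positive weights as soon as it is strict at one
vertex. -/
theorem pos_of_posOn {u v : Pt} {t : Tri} (h : posOn u v t = true)
    {w : ℝ × ℝ × ℝ} (hw : IsPosWeight w) : 0 < side (evPt u) (evPt v) (comb w t) := by
  simp only [posOn, nonnegOn, Bool.and_eq_true, Bool.or_eq_true] at h
  obtain ⟨⟨⟨h1, h2⟩, h3⟩, h4⟩ := h
  rw [side_comb hw.sum]
  have := mul_nonneg hw.fst.le (ev_nonneg h1)
  have := mul_nonneg hw.snd.le (ev_nonneg h2)
  have := mul_nonneg hw.trd.le (ev_nonneg h3)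
  rcases h4 with (h4 | h4) | h4
  · have := mul_pos hw.fst (ev_pos h4); linarith
  · have := mul_pos hw.snd (ev_pos h4); linarith
  · have := mul_pos hw.trd (ev_pos h4); linarith

/-- Strict inequalities at the vertices hold on the closed triangle. -/
theorem pos_of_allPosOn {u v : Pt} {t : Tri} (h : allPosOn u v t = true)
    {w : ℝ × ℝ × ℝ} (hw : IsWeight w) : 0 < side (evPt u) (evPt v) (comb w t) := by
  simp only [allPosOn, Bool.and_eq_true] at h
  obtain ⟨⟨h1, h2⟩, h3⟩ := h
  rw [side_comb hw.sum]
  have h1 := ev_pos h1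
  have h2 := ev_pos h2
  have h3 := ev_pos h3
  obtain ⟨w1, w2, w3, ws⟩ := hw
  by_contra! hc
  have e1 := mul_nonneg w1 h1.le
  have e2 := mul_nonneg w2 h2.le
  have e3 := mul_nonneg w3 h3.le
  have z1 : w.1 = 0 := (mul_eq_zero.1 (by linarith)).resolve_right h1.ne'
  have z2 : w.2.1 = 0 := (mul_eq_zero.1 (by linarith)).resolve_right h2.ne'
  have z3 : w.2.2 = 0 := (mul_eq_zero.1 (by linarith)).resolve_right h3.ne'
  linarith

/-- Barycentric coordinates are quotients of oriented areas. -/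
theorem exists_bary {a b c q : ℝ × ℝ} (h : 0 < side a b c) :
    ∃ w : ℝ × ℝ × ℝ, w.1 + w.2.1 + w.2.2 = 1 ∧ bary w a b c = q ∧
      w.1 * side a b c = side b c q ∧ w.2.1 * side a b c = side c a q ∧
      w.2.2 * side a b c = side a b q := by
  have h0 := h.ne'
  have e : side b c q + side c a q + side a b q = side a b c := by simp only [side]; ring
  refine ⟨(side b c q / side a b c, side c a q / side a b c, side a b q / side a b c),
    ?_, ?_, ?_, ?_, ?_⟩
  · rw [← add_div, ← add_div, e, div_self h0]
  · ext
    · simp only [bary]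
      field_simp
      simp only [side]; ring
    · simp only [bary]
      field_simp
      simp only [side]; ring
  all_goals simp only; field_simp

theorem exists_comb {t : Tri} {q : ℝ × ℝ} (h1 : 0 < side (evPt t.1) (evPt t.2.1) q)
    (h2 : 0 < side (evPt t.2.1) (evPt t.2.2) q) (h3 : 0 < side (evPt t.2.2) (evPt t.1) q) :
    ∃ w, IsPosWeight w ∧ comb w t = q := by
  have e : side (evPt t.2.1) (evPt t.2.2) q + side (evPt t.2.2) (evPt t.1) q +
    side (evPt t.1) (evPt t.2.1) q = side (evPt t.1) (evPt t.2.1) (evPt t.2.2) := by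
    simp only [side]; ring
  have h : 0 < side (evPt t.1) (evPt t.2.1) (evPt t.2.2) := by linarith
  obtain ⟨w, ws, hq, e1, e2, e3⟩ := exists_bary (q := q) h
  refine ⟨w, ⟨?_, ?_, ?_, ws⟩, hq⟩
  · exact pos_of_mul_pos_left (e1 ▸ h2) h.le
  · exact pos_of_mul_pos_left (e2 ▸ h3) h.le
  · exact pos_of_mul_pos_left (e3 ▸ h1) h.le

/-- A point on the line `ab`, on the proper side of the other two sides of a triangle `abc`,
lies on the open segment `ab`. -/
theorem exists_comb_segment {a b c : Pt} {q : ℝ × ℝ} (h1 : side (evPt a) (evPt b) q = 0)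
    (h2 : 0 < side (evPt b) (evPt c) q) (h3 : 0 < side (evPt c) (evPt a) q) :
    ∃ w, IsPosWeight w ∧ comb w (a, b, b) = q := by
  have e : side (evPt b) (evPt c) q + side (evPt c) (evPt a) q +
    side (evPt a) (evPt b) q = side (evPt a) (evPt b) (evPt c) := by
    simp only [side]; ring
  have h : 0 < side (evPt a) (evPt b) (evPt c) := by linarith
  obtain ⟨w, ws, hq, e1, e2, e3⟩ := exists_bary (q := q) h
  have z : w.2.2 = 0 := (mul_eq_zero.1 (e3.trans h1)).resolve_right h.ne'
  have p1 : 0 < w.1 := pos_of_mul_pos_left (e1 ▸ h2) h.le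
  have p2 : 0 < w.2.1 := pos_of_mul_pos_left (e2 ▸ h3) h.le
  refine ⟨(w.1, w.2.1 / 2, w.2.1 / 2), ⟨p1, half_pos p2, half_pos p2, ?_⟩, ?_⟩
  · simp only; linarith
  · rw [← hq]
    simp only [comb, bary, z]
    ext <;> simp only <;> ring

theorem rotate_comb (w : ℝ × ℝ × ℝ) (t : Tri) :
    rotate √2 (comb w t) = comb w (t.map (rotate zs)) := by
  simp only [comb, Tri.map, ← rotate_evPt]
  simp only [bary, rotate]
  ext <;> simp only <;> ring

theorem Tri.map_map (f g : Pt → Pt) (t : Tri) : (t.map f).map g = t.map (g ∘ f) := rfl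

theorem rotate_iterate_comb (w : ℝ × ℝ × ℝ) (k : ℕ) (t : Tri) :
    (rotate √2)^[k] (comb w t) = comb w (t.map (rotate zs)^[k]) := by
  induction k generalizing t with
  | zero => rfl
  | succ n ih =>
    rw [Function.iterate_succ_apply, rotate_comb, ih, Tri.map_map, Function.iterate_succ]

theorem branch_comb {w : ℝ × ℝ × ℝ} (hw : w.1 + w.2.1 + w.2.2 = 1) (k : ℕ) (t : Tri) :
    branch √2 k (comb w t) = comb w (t.map (branch zs k)) := by
  simp only [branch, rotate_iterate_comb]
  have h4 : ev 4 = 4 := map_ofNat ev 4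
  ext
  · simp only [comb, bary, Tri.map, evPt, branch, map_neg]; ring
  · simp only [comb, bary, Tri.map, evPt, branch, map_sub, h4]; linear_combination -4 * hw

theorem renorm_evPt (p : Pt) : renorm √2 (evPt p) = evPt (renorm zs p) := by
  have h2 : ev 2 = 2 := map_ofNat ev 2
  have h3 : ev 3 = 3 := map_ofNat ev 3
  have h4 : ev 4 = 4 := map_ofNat ev 4
  have e : ((evPt p).1, (evPt p).2 - 2) = evPt (p.1, p.2 - 2) := by simp [evPt, h2]
  simp only [renorm, e, rotate_iterate_evPt]
  simp [evPt, h2, h3, h4]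

theorem renorm_comb {w : ℝ × ℝ × ℝ} (hw : w.1 + w.2.1 + w.2.2 = 1) (t : Tri) :
    renorm √2 (comb w t) = comb w (t.map (renorm zs)) := by
  have e : ((comb w t).1, (comb w t).2 - 2) = comb w (t.map (fun p => (p.1, p.2 - 2))) := by
    have h2 : ev 2 = 2 := map_ofNat ev 2
    ext
    · simp [comb, bary, Tri.map, evPt]
    · simp only [comb, bary, Tri.map, evPt, map_sub, h2]; linear_combination 2 * hw
  simp only [renorm, e, rotate_iterate_comb, Tri.map_map]
  simp only [comb, Tri.map]
  have h2 : ev 2 = 2 := map_ofNat ev 2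
  have h3 : ev 3 = 3 := map_ofNat ev 3
  have h4 : ev 4 = 4 := map_ofNat ev 4
  ext
  · simp only [bary, evPt, renorm, Function.comp, map_add, map_neg, map_mul, map_sub, h2, h3, h4,
      ev_zs]
    linear_combination 4 * hw
  · simp only [bary, evPt, renorm, Function.comp, map_add, map_neg, map_mul, map_sub, h2, h3, h4,
      ev_zs]
    linear_combination -(2 + 2 * √2) * hw

/-! ### Oblique coordinates on the complex plane -/

theorem rot8_eq : rot8 = ⟨√2 / 2, √2 / 2⟩ := by
  rw [rot8, Complex.exp_mul_I, ← Complex.ofReal_cos, ← Complex.ofReal_sin,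
    Real.cos_pi_div_four, Real.sin_pi_div_four]
  apply Complex.ext <;> simp

theorem rot8_sq : rot8 ^ 2 = (√2 : ℝ) * rot8 - 1 := by
  have := sqrtTwo_sq
  rw [rot8_eq, sq]
  apply Complex.ext <;> simp
  · nlinarith
  · ring

theorem rot8_pow_eight : rot8 ^ 8 = 1 := by
  rw [rot8, ← Complex.exp_nat_mul, Complex.exp_eq_one_iff]
  exact ⟨1, by push_cast; ring⟩

theorem rot8_ne_zero : rot8 ≠ 0 := Complex.exp_ne_zero _

theorem normSq_rot8 : Complex.normSq rot8 = 1 := by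
  have := sqrtTwo_sq
  rw [rot8_eq, Complex.normSq_mk]; nlinarith

/-- The point of the plane with given oblique coordinates: the octagon has centre `z`, a vertex
`z + a`, and the unit of length is half of its circumradius. -/
noncomputable def emb (z a : ℂ) (q : ℝ × ℝ) : ℂ := z + a / 2 * (q.1 + q.2 * rot8)

theorem emb_rotate (z a : ℂ) (q : ℝ × ℝ) :
    emb z a (rotate √2 q) = z + rot8 * (emb z a q - z) := by
  simp only [emb, rotate]
  push_cast
  linear_combination (-(a / 2) * q.2) * rot8_sq

theorem emb_rotate_iterate (z a : ℂ) (k : ℕ) (q : ℝ × ℝ) :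
    emb z a ((rotate √2)^[k] q) = z + rot8 ^ k * (emb z a q - z) := by
  induction k with
  | zero => simp
  | succ n ih => rw [Function.iterate_succ_apply', emb_rotate, ih]; ring

/-- The oblique coordinates of a point of the plane. -/
noncomputable def coord (z a : ℂ) (w : ℂ) : ℝ × ℝ :=
  (((w - z) / (a / 2)).re - ((w - z) / (a / 2)).im, √2 * ((w - z) / (a / 2)).im)

theorem emb_coord {z a : ℂ} (ha : a ≠ 0) (w : ℂ) : emb z a (coord z a w) = w := by
  have h : ((coord z a w).1 + (coord z a w).2 * rot8 : ℂ) = (w - z) / (a / 2) := by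
    have := sqrtTwo_sq
    simp only [coord, rot8_eq]
    generalize (w - z) / (a / 2) = u
    apply Complex.ext <;> simp
    · linear_combination u.im / 2 * this
    · linear_combination u.im / 2 * this
  rw [emb, h]
  field_simp
  ring

theorem coord_emb {z a : ℂ} (ha : a ≠ 0) (q : ℝ × ℝ) : coord z a (emb z a q) = q := by
  have h : (emb z a q - z) / (a / 2) = q.1 + q.2 * rot8 := by
    rw [emb]; field_simp; ring
  have := sqrtTwo_sq
  ext
  · simp [coord, h, rot8_eq]
  · simp [coord, h, rot8_eq]
    linear_combination q.2 / 2 * this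

theorem emb_injective {z a : ℂ} (ha : a ≠ 0) : Function.Injective (emb z a) :=
  Function.LeftInverse.injective (coord_emb ha)

@[fun_prop]
theorem continuous_coord (z a : ℂ) : Continuous (coord z a) := by
  unfold coord; fun_prop

theorem emb_bary (z a : ℂ) {w : ℝ × ℝ × ℝ} (hw : w.1 + w.2.1 + w.2.2 = 1) (p q r : ℝ × ℝ) :
    emb z a (bary w p q r) =
      w.1 • emb z a p + w.2.1 • emb z a q + w.2.2 • emb z a r := by
  have h : (w.1 + w.2.1 + w.2.2 : ℂ) = 1 := by exact_mod_cast hw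
  simp only [emb, bary, Complex.real_smul]
  push_cast
  linear_combination (-z) * h

theorem emb_comb_mem {z a : ℂ} {S : Set ℂ} (hS : Convex ℝ S) {w : ℝ × ℝ × ℝ} (hw : IsWeight w)
    {t : Tri} (h1 : emb z a (evPt t.1) ∈ S) (h2 : emb z a (evPt t.2.1) ∈ S)
    (h3 : emb z a (evPt t.2.2) ∈ S) : emb z a (comb w t) ∈ S := by
  rw [comb, emb_bary z a hw.sum]
  have := hS.sum_mem (t := Finset.univ) (w := ![w.1, w.2.1, w.2.2])
    (z := ![emb z a (evPt t.1), emb z a (evPt t.2.1), emb z a (evPt t.2.2)])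
    (by simpa [Fin.forall_fin_succ] using ⟨hw.fst, hw.snd, hw.trd⟩)
    (by simpa [Fin.sum_univ_three] using hw.sum)
    (by simpa [Fin.forall_fin_succ] using ⟨h1, h2, h3⟩)
  simpa [Fin.sum_univ_three] using this

theorem emb_mem_of_isNonneg {z a : ℂ} {S : Set ℂ} (hS : Convex ℝ S) {T : Tri} {p : Pt}
    (h : isPos (side T.1 T.2.1 T.2.2) = true) (h1 : isNonneg (side T.1 T.2.1 p) = true)
    (h2 : isNonneg (side T.2.1 T.2.2 p) = true) (h3 : isNonneg (side T.2.2 T.1 p) = true)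
    (m1 : emb z a (evPt T.1) ∈ S) (m2 : emb z a (evPt T.2.1) ∈ S)
    (m3 : emb z a (evPt T.2.2) ∈ S) : emb z a (evPt p) ∈ S := by
  have h := ev_pos h
  have h1 := ev_nonneg h1
  have h2 := ev_nonneg h2
  have h3 := ev_nonneg h3
  rw [← side_evPt] at h h1 h2 h3
  obtain ⟨w, ws, hq, e1, e2, e3⟩ := exists_bary (q := evPt p) h
  rw [← e1] at h2
  rw [← e2] at h3
  rw [← e3] at h1
  rw [← hq]
  exact emb_comb_mem hS (t := T) ⟨nonneg_of_mul_nonneg_left h2 h, nonneg_of_mul_nonneg_left h3 h,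
    nonneg_of_mul_nonneg_left h1 h, ws⟩ m1 m2 m3

/-- The factor between `side` and the cross product in the plane. -/
noncomputable def areaUnit (a : ℂ) : ℝ := Complex.normSq a / 4 * (√2 / 2)

theorem areaUnit_pos {a : ℂ} (ha : a ≠ 0) : 0 < areaUnit a := by
  have := Complex.normSq_pos.2 ha
  unfold areaUnit; positivity

theorem crossProd_emb (z a : ℂ) (p q r : ℝ × ℝ) :
    crossProd (emb z a q - emb z a p) (emb z a r - emb z a p) = areaUnit a * side p q r := by
  simp [crossProd, emb, side, areaUnit, rot8_eq, Complex.normSq_apply]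
  ring

theorem octVertex_eq (z a : ℂ) (k : ℕ) : octVertex z a k = emb z a (evPt (vA k)) := by
  have h2 : ev 2 = 2 := map_ofNat ev 2
  rw [vA, ← rotate_iterate_evPt, emb_rotate_iterate, octVertex]
  simp [emb, evPt, h2]
  ring

theorem dartR_eq (z a : ℂ) : dartR z a = emb z a (evPt vR) := by
  have h : ((√2 : ℝ) : ℂ) * (√2 : ℝ) = 2 := by exact_mod_cast sqrtTwo_sq
  have h0 : ((√2 : ℝ) : ℂ) ≠ 0 := fun h' => by simp [h'] at h
  have e : ∀ u : ℂ, u / (√2 : ℝ) = u * (√2 : ℝ) / 2 := fun u => by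
    field_simp; linear_combination -u * h
  simp only [dartR, octVertex, e, emb, evPt, vR, ev_apply]
  push_cast
  linear_combination (a + a * (√2 : ℝ) / 2) * rot8_sq + a / 2 * rot8 * h

theorem dartO_eq (z a : ℂ) : dartO z a = emb z a (evPt (vA 1)) := octVertex_eq z a 1

theorem pointReflection_emb (z a : ℂ) (p q : Pt) :
    Equiv.pointReflection (emb z a (evPt p)) (emb z a (evPt q)) =
      emb z a (evPt (2 * p.1 - q.1, 2 * p.2 - q.2)) := by
  have h2 : ev 2 = 2 := map_ofNat ev 2
  simp [Equiv.pointReflection_apply, emb, evPt, h2]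
  ring

theorem dartK_eq (z a : ℂ) : dartK z a = emb z a (evPt vK) := by
  rw [dartK, dartR_eq, octVertex_eq, pointReflection_emb]; rfl

theorem dartL_eq (z a : ℂ) : dartL z a = emb z a (evPt vL) := by
  rw [dartL, dartR_eq, octVertex_eq, pointReflection_emb]; rfl

theorem dartM_eq (z a : ℂ) : dartM z a = emb z a (evPt vM) := by
  rw [dartM, dartR_eq, octVertex_eq, pointReflection_emb]; rfl

theorem dart_eq (z a : ℂ) : dart z a =
    convexHull ℝ {emb z a (evPt (vA 1)), emb z a (evPt vK), emb z a (evPt vR)} ∪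
    convexHull ℝ {emb z a (evPt vR), emb z a (evPt vL), emb z a (evPt vM)} := by
  rw [dart, dartO_eq, dartK_eq, dartR_eq, dartL_eq, dartM_eq]

/-! ### The outer billiard map -/

theorem mem_outerBilliard {γ : Set ℂ} {p w : ℂ} : w ∈ outerBilliard γ p ↔
    p ∉ γ ∧ ∃ q, IsRightTangentPoint γ p q ∧ (∀ q', IsRightTangentPoint γ p q' → q' = q) ∧
      w = Equiv.pointReflection q p := by
  constructor
  · rintro ⟨h, rfl⟩
    exact ⟨h.1, h.2.choose, h.2.choose_spec.1, h.2.choose_spec.2, rfl⟩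
  · rintro ⟨h, q, hq, hu, rfl⟩
    have h' : ∃! q, IsRightTangentPoint γ p q := ⟨q, hq, hu⟩
    refine ⟨⟨h, h'⟩, ?_⟩
    change Equiv.pointReflection h'.choose p = _
    rw [hu _ h'.choose_spec.1]

/-- The point of tangency is recovered from the image as the point of tangency of the left tangent,
which is unique as well. -/
theorem outerBilliard_injective {γ : Set ℂ} {p p' w : ℂ} (h : w ∈ outerBilliard γ p)
    (h' : w ∈ outerBilliard γ p') : p = p' := by
  rw [mem_outerBilliard] at h h'
  obtain ⟨hp, q, ⟨hq, ht⟩, hu, hw⟩ := h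
  obtain ⟨hp', q', ⟨hq', ht'⟩, hu', hw'⟩ := h'
  obtain rfl : p = 2 * q - w := by rw [hw, Equiv.pointReflection_apply]; simp; ring
  obtain rfl : p' = 2 * q' - w := by rw [hw', Equiv.pointReflection_apply]; simp; ring
  suffices q = q' by rw [this]
  clear hw hw'
  have h1 := ht q' hq'
  have h2 := ht' q hq
  simp only [crossProd] at ht ht' h1 h2
  simp only [Complex.sub_re, Complex.sub_im, Complex.mul_re, Complex.mul_im, Complex.re_ofNat,
    Complex.im_ofNat, zero_mul, sub_zero, add_zero] at ht ht' h1 h2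
  -- neither tangent has the other point of tangency on its right, and both pass through `w`
  have h0 : (w.re - q.re) * (w.im - q'.im) - (w.im - q.im) * (w.re - q'.re) = 0 := by linarith
  by_contra hne
  have hwq : w ≠ q := by
    rintro rfl; exact hp (by convert hq using 1; ring)
  have hwq' : w ≠ q' := by
    rintro rfl; exact hp' (by convert hq' using 1; ring)
  -- if `w - q' = t (w - q)` with `t < 2`, then `q'` is a tangency point for `2 q - w` as well
  have key : ∀ q q' : ℂ, w ≠ q →
      (∀ x ∈ γ, 0 ≤ (q.re - (2 * q.re - w.re)) * (x.im - (2 * q.im - w.im)) -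
        (q.im - (2 * q.im - w.im)) * (x.re - (2 * q.re - w.re))) → q' ∈ γ →
      (w.re - q.re) * (w.im - q'.im) - (w.im - q.im) * (w.re - q'.re) = 0 →
      (w.re - q.re) * (w.re - q'.re) + (w.im - q.im) * (w.im - q'.im) <
        2 * ((w.re - q.re) ^ 2 + (w.im - q.im) ^ 2) →
      IsRightTangentPoint γ (2 * q - w) q' := by
    intro q q' hwq ht hq' h0 hlt
    have hN : 0 < (w.re - q.re) ^ 2 + (w.im - q.im) ^ 2 := by
      by_contra! hN
      apply hwq
      apply Complex.ext <;> nlinarith [sq_nonneg (w.re - q.re), sq_nonneg (w.im - q.im)]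
    refine ⟨hq', fun x hx => ?_⟩
    have := ht x hx
    simp only [crossProd, Complex.sub_re, Complex.sub_im, Complex.mul_re, Complex.mul_im,
      Complex.re_ofNat, Complex.im_ofNat, zero_mul, sub_zero, add_zero]
    refine nonneg_of_mul_nonneg_right (a := (w.re - q.re) ^ 2 + (w.im - q.im) ^ 2) ?_ hN
    have e := mul_nonneg (sub_nonneg.2 hlt.le) this
    convert e using 1
    linear_combination
      ((w.re - q.re) * (x.re - (2 * q.re - w.re)) +
        (w.im - q.im) * (x.im - (2 * q.im - w.im))) * h0
  rcases lt_or_ge ((w.re - q.re) * (w.re - q'.re) + (w.im - q.im) * (w.im - q'.im))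
    (2 * ((w.re - q.re) ^ 2 + (w.im - q.im) ^ 2)) with hc | hc
  · exact hne (hu q' (key q q' hwq ht hq' h0 hc)).symm
  · refine hne (hu' q (key q' q hwq' ht' hq (by linarith) ?_))
    -- `(w - q') = t (w - q)` with `t ≥ 2`
    have hN : 0 < (w.re - q.re) ^ 2 + (w.im - q.im) ^ 2 := by
      by_contra! hN
      apply hwq
      apply Complex.ext <;> nlinarith [sq_nonneg (w.re - q.re), sq_nonneg (w.im - q.im)]
    set D := (w.re - q.re) * (w.re - q'.re) + (w.im - q.im) * (w.im - q'.im) with hD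
    set N := (w.re - q.re) ^ 2 + (w.im - q.im) ^ 2 with hN'
    have e : N * ((w.re - q'.re) ^ 2 + (w.im - q'.im) ^ 2) = D ^ 2 := by
      rw [hD, hN']
      linear_combination ((w.re - q.re) * (w.im - q'.im) - (w.im - q.im) * (w.re - q'.re)) * h0
    have hDc : (w.re - q'.re) * (w.re - q.re) + (w.im - q'.im) * (w.im - q.im) = D := by
      rw [hD]; ring
    rw [hDc]
    by_contra! hlt
    nlinarith

theorem convex_crossProd_nonneg (u p : ℂ) : Convex ℝ {x : ℂ | 0 ≤ crossProd u (x - p)} := by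
  intro x hx y hy α β hα hβ hs
  simp only [mem_ofPred_eq, crossProd, Complex.sub_re, Complex.sub_im, Complex.add_re,
    Complex.add_im, Complex.real_smul, Complex.re_ofReal_mul, Complex.im_ofReal_mul] at hx hy ⊢
  have h1 := mul_nonneg hα hx
  have h2 := mul_nonneg hβ hy
  obtain rfl : β = 1 - α := by linarith
  linarith

/-- Adding to an open half-plane a point of its boundary line gives a convex set. -/
theorem convex_insert_crossProd_pos {q p : ℂ} :
    Convex ℝ (insert q {x : ℂ | 0 < crossProd (q - p) (x - p)}) := by
  have hq : crossProd (q - p) (q - p) = 0 := by simp only [crossProd]; ring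
  have aff : ∀ (x y : ℂ) (α β : ℝ), α + β = 1 → crossProd (q - p) (α • x + β • y - p) =
      α * crossProd (q - p) (x - p) + β * crossProd (q - p) (y - p) := by
    intro x y α β h
    obtain rfl : β = 1 - α := by linarith
    simp only [crossProd, Complex.sub_re, Complex.sub_im, Complex.add_re,
      Complex.add_im, Complex.real_smul, Complex.re_ofReal_mul, Complex.im_ofReal_mul]
    ring
  intro x hx y hy α β hα hβ hs
  rcases eq_or_lt_of_le hα with rfl | hα
  · obtain rfl : β = 1 := by linarith
    simpa using hy
  rcases eq_or_lt_of_le hβ with rfl | hβ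
  · obtain rfl : α = 1 := by linarith
    simpa using hx
  rcases hx with rfl | hx <;> rcases hy with rfl | hy
  · left; rw [← add_smul, hs, one_smul]
  · right
    have := mul_pos hβ hy
    rw [mem_ofPred_eq, aff _ _ _ _ hs, hq]; linarith
  · right
    have := mul_pos hα hx
    rw [mem_ofPred_eq, aff _ _ _ _ hs, hq]; linarith
  · right
    have := mul_pos hβ hy
    have := mul_pos hα hx
    rw [mem_ofPred_eq, aff _ _ _ _ hs]; linarith

theorem octVertex_mod (z a : ℂ) (k : ℕ) : octVertex z a (k % 8) = octVertex z a k := by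
  conv_rhs => rw [← Nat.div_add_mod k 8]
  simp [octVertex, pow_add, pow_mul, rot8_pow_eight]

theorem octVertex_mem (z a : ℂ) (k : ℕ) : octVertex z a k ∈ octagon z a :=
  subset_convexHull ℝ _ (mem_range_self k)

theorem octagon_subset {z a : ℂ} {S : Set ℂ} (hS : Convex ℝ S)
    (h : ∀ j < 8, octVertex z a j ∈ S) : octagon z a ⊆ S := by
  refine convexHull_min ?_ hS
  rintro _ ⟨k, rfl⟩
  rw [← octVertex_mod]
  exact h _ (Nat.mod_lt _ (by norm_num))

/-- A point to the right of the line `A₁A₂` is outside the octagon. -/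
theorem not_mem_octagon {z a : ℂ} (ha : a ≠ 0) {q : ℝ × ℝ}
    (h : side (evPt (vA 1)) (evPt (vA 2)) q < 0) : emb z a q ∉ octagon z a := by
  intro hm
  have hsub : octagon z a ⊆ {x : ℂ | 0 ≤ crossProd (octVertex z a 2 - octVertex z a 1)
      (x - octVertex z a 1)} := by
    refine octagon_subset (convex_crossProd_nonneg _ _) fun j hj => ?_
    rw [mem_ofPred_eq, octVertex_eq, octVertex_eq, octVertex_eq, crossProd_emb, side_evPt]
    refine mul_nonneg (areaUnit_pos ha).le (ev_nonneg ?_)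
    revert j; decide +kernel
  have := hsub hm
  rw [mem_ofPred_eq, octVertex_eq, octVertex_eq, crossProd_emb] at this
  nlinarith [areaUnit_pos ha]

/-- The hypothesis says that `A_k`, seen from the point `q`, has no vertex on its right. -/
theorem isRightTangentPoint_octVertex {z a : ℂ} (ha : a ≠ 0) {q : ℝ × ℝ} {k : ℕ}
    (h : ∀ j < 8, 0 ≤ side (evPt (vA k)) (evPt (vA j)) q) :
    IsRightTangentPoint (octagon z a) (emb z a q) (octVertex z a k) := by
  have hsub := octagon_subset (z := z) (a := a)
    (convex_crossProd_nonneg (octVertex z a k - emb z a q) (emb z a q)) (fun j hj => ?_)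
  · exact ⟨octVertex_mem z a k, fun x hx => hsub hx⟩
  rw [mem_ofPred_eq, octVertex_eq, octVertex_eq, crossProd_emb, side_rotate, side_rotate]
  exact mul_nonneg (areaUnit_pos ha).le (h j hj)

theorem mem_outerBilliard_octagon {z a : ℂ} (ha : a ≠ 0) {q : ℝ × ℝ} {k : ℕ}
    (hq : side (evPt (vA 1)) (evPt (vA 2)) q < 0)
    (h : ∀ j < 8, j ≠ k → 0 < side (evPt (vA k)) (evPt (vA j)) q) :
    2 * octVertex z a k - emb z a q ∈ outerBilliard (octagon z a) (emb z a q) := by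
  rw [mem_outerBilliard]
  refine ⟨not_mem_octagon ha hq, octVertex z a k, isRightTangentPoint_octVertex ha ?_, ?_, ?_⟩
  · intro j hj
    by_cases hjk : j = k
    · subst hjk; simp [side]
    · exact (h j hj hjk).le
  · intro q' hq'
    have hsub := octagon_subset (z := z) (a := a)
      (convex_insert_crossProd_pos (q := octVertex z a k) (p := emb z a q)) (fun j hj => by
        by_cases hjk : j = k
        · left; rw [hjk]
        · right
          rw [mem_ofPred_eq, octVertex_eq, octVertex_eq, crossProd_emb, side_rotate, side_rotate]
          exact mul_pos (areaUnit_pos ha) (h j hj hjk))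
    rcases hsub hq'.1 with h1 | h1
    · exact h1
    · have := hq'.2 _ (octVertex_mem z a k)
      simp only [mem_ofPred_eq, crossProd] at h1 this
      linarith
  · rw [Equiv.pointReflection_apply]; simp; ring

theorem rotate_mem_octagon {z a x : ℂ} (k : ℕ) (hx : x ∈ octagon z a) :
    z + rot8 ^ k * (x - z) ∈ octagon z a := by
  have hc : Convex ℝ ((fun x => z + rot8 ^ k * (x - z)) ⁻¹' octagon z a) := by
    intro x hx y hy α β hα hβ hs
    have hs' : (α : ℂ) + β = 1 := by exact_mod_cast hs
    have : α • (z + rot8 ^ k * (x - z)) + β • (z + rot8 ^ k * (y - z)) ∈ octagon z a :=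
      convex_convexHull ℝ (range (octVertex z a)) hx hy hα hβ hs
    rw [mem_preimage]
    convert this using 1
    simp only [Complex.real_smul]
    linear_combination (-z + rot8 ^ k * z) * hs'
  refine octagon_subset hc (fun j hj => ?_) hx
  rw [mem_preimage]
  convert octVertex_mem z a (j + k) using 1
  simp only [octVertex]; ring

theorem crossProd_mul (u v w : ℂ) :
    crossProd (u * v) (u * w) = Complex.normSq u * crossProd v w := by
  simp [crossProd, Complex.normSq_apply]; ring

theorem isRightTangentPoint_rotate {z a p q : ℂ} (k : ℕ)
    (h : IsRightTangentPoint (octagon z a) p q) :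
    IsRightTangentPoint (octagon z a) (z + rot8 ^ k * (p - z)) (z + rot8 ^ k * (q - z)) := by
  refine ⟨rotate_mem_octagon k h.1, fun x hx => ?_⟩
  have e : rot8 ^ k * rot8 ^ (7 * k) = 1 := by
    rw [← pow_add, show k + 7 * k = 8 * k by ring, pow_mul, rot8_pow_eight, one_pow]
  have := h.2 _ (rotate_mem_octagon (7 * k) hx)
  have e1 : z + rot8 ^ k * (q - z) - (z + rot8 ^ k * (p - z)) = rot8 ^ k * (q - p) := by ring
  have e2 : x - (z + rot8 ^ k * (p - z)) =
      rot8 ^ k * (z + rot8 ^ (7 * k) * (x - z) - p) := by linear_combination (z - x) * e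
  rw [e1, e2, crossProd_mul, map_pow, normSq_rot8, one_pow, one_mul]
  exact this

theorem rotate_rotate_inv (z p : ℂ) (k : ℕ) :
    z + rot8 ^ (7 * k) * (z + rot8 ^ k * (p - z) - z) = p := by
  have e : rot8 ^ (7 * k) * rot8 ^ k = 1 := by
    rw [← pow_add, show 7 * k + k = 8 * k by ring, pow_mul, rot8_pow_eight, one_pow]
  linear_combination (p - z) * e

theorem rotate_inv_rotate (z p : ℂ) (k : ℕ) :
    z + rot8 ^ k * (z + rot8 ^ (7 * k) * (p - z) - z) = p := by
  have e : rot8 ^ (7 * k) * rot8 ^ k = 1 := by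
    rw [← pow_add, show 7 * k + k = 8 * k by ring, pow_mul, rot8_pow_eight, one_pow]
  linear_combination (p - z) * e

theorem outerBilliard_rotate {z a p w : ℂ} (k : ℕ) (h : w ∈ outerBilliard (octagon z a) p) :
    z + rot8 ^ k * (w - z) ∈ outerBilliard (octagon z a) (z + rot8 ^ k * (p - z)) := by
  rw [mem_outerBilliard] at h ⊢
  obtain ⟨hp, q, hq, hu, rfl⟩ := h
  refine ⟨fun hm => hp ?_, z + rot8 ^ k * (q - z), isRightTangentPoint_rotate k hq, ?_, ?_⟩
  · have := rotate_mem_octagon (7 * k) hm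
    rwa [rotate_rotate_inv] at this
  · intro q' hq'
    have := isRightTangentPoint_rotate (7 * k) hq'
    rw [rotate_rotate_inv] at this
    rw [← hu _ this, rotate_inv_rotate]
  · simp only [Equiv.pointReflection_apply, vsub_eq_sub, vadd_eq_add]
    ring

/-! ### The open quadrilateral and the reduced map -/

/-- The open quadrilateral `OKLM` in oblique coordinates. Its angle at `L` is reflex, hence the
disjunction for the sides `KL` and `LM`. -/
def dartInt : Set (ℝ × ℝ) :=
  {q | 0 < side (evPt (vA 1)) (evPt vK) q ∧ 0 < side (evPt vM) (evPt (vA 1)) q ∧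
    (0 < side (evPt vK) (evPt vR) q ∨ 0 < side (evPt vL) (evPt vM) q)}

theorem mem_dartInt_of_insideDart {t : Tri} (h : insideDart t = true) {w : ℝ × ℝ × ℝ}
    (hw : IsPosWeight w) : comb w t ∈ dartInt := by
  simp only [insideDart, Bool.and_eq_true, Bool.or_eq_true] at h
  exact ⟨pos_of_posOn h.1.1 hw, pos_of_posOn h.1.2 hw,
    h.2.imp (fun h => pos_of_posOn h hw) (fun h => pos_of_posOn h hw)⟩

theorem pos_iff_of_sameLine {u v u' v' : Pt} (h : sameLine u v u' v' = true) (q : ℝ × ℝ) :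
    0 < side (evPt u) (evPt v) q ↔ 0 < side (evPt u') (evPt v') q := by
  simp only [sameLine, Bool.and_eq_true, decide_eq_true_eq] at h
  obtain ⟨⟨h1, h2⟩, h3⟩ := h
  have h1 : side (evPt u) (evPt v) (evPt u') = 0 := by rw [side_evPt, h1, map_zero]
  have h2 : side (evPt u) (evPt v) (evPt v') = 0 := by rw [side_evPt, h2, map_zero]
  have h3 := ev_pos h3
  simp only [map_add, map_mul, map_sub] at h3
  change 0 < ((evPt v).1 - (evPt u).1) * ((evPt v').1 - (evPt u').1) +
    ((evPt v).2 - (evPt u).2) * ((evPt v').2 - (evPt u').2) at h3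
  generalize evPt u = u at *
  generalize evPt v = v at *
  generalize evPt u' = u' at *
  generalize evPt v' = v' at *
  have hN : 0 < (v.1 - u.1) ^ 2 + (v.2 - u.2) ^ 2 := by
    by_contra! hN
    have e1 : v.1 - u.1 = 0 := by nlinarith [sq_nonneg (v.1 - u.1), sq_nonneg (v.2 - u.2)]
    have e2 : v.2 - u.2 = 0 := by nlinarith [sq_nonneg (v.1 - u.1), sq_nonneg (v.2 - u.2)]
    rw [e1, e2] at h3; simp at h3
  have key : ((v.1 - u.1) ^ 2 + (v.2 - u.2) ^ 2) * side u' v' q =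
      ((v.1 - u.1) * (v'.1 - u'.1) + (v.2 - u.2) * (v'.2 - u'.2)) * side u v q := by
    simp only [side] at h1 h2 ⊢
    linear_combination (-((v.1 - u.1) * (v'.1 - u'.1) + (v.2 - u.2) * (v'.2 - u'.2))) * h1 -
      ((v.1 - u.1) * (q.1 - u'.1) + (v.2 - u.2) * (q.2 - u'.2)) * (h2 - h1)
  rw [← mul_pos_iff_of_pos_left (b := side u' v' q) hN, key, mul_pos_iff_of_pos_left h3]

theorem neg_iff_of_sameLine {u v u' v' : Pt} (h : sameLine v u u' v' = true) (q : ℝ × ℝ) :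
    side (evPt u) (evPt v) q < 0 ↔ 0 < side (evPt u') (evPt v') q := by
  rw [← pos_iff_of_sameLine h, side_swap (evPt v) (evPt u), neg_lt_zero]

/-- A triangulation of the three domains of continuity of the reduced map together with the two
segments between them. -/
inductive IsCell : Tri → Prop
  | two : IsCell cellTwo
  | three_left : IsCell cellThreeLeft
  | three_right : IsCell cellThreeRight
  | three_mid : IsCell cellThreeMid
  | four : IsCell cellFour
  | seg_two : IsCell cellSegTwo
  | seg_three : IsCell cellSegThree

theorem exists_cell {q : ℝ × ℝ} (hq : q ∈ dartInt) :
    ∃ t w, IsCell t ∧ IsPosWeight w ∧ comb w t = q := by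
  obtain ⟨hO, hM, hKL⟩ := hq
  have l1 := (pos_iff_of_sameLine (u' := vA 1) (v' := vX) (by decide +kernel) q).1 hO
  have l2 := (pos_iff_of_sameLine (u' := vA 2) (v' := vA 1) (by decide +kernel) q).1 hM
  have l3 := (pos_iff_of_sameLine (u' := vX) (v' := vK) (by decide +kernel) q).1 hO
  have l4 := (pos_iff_of_sameLine (u' := vR) (v' := vA 2) (by decide +kernel) q).1 hM
  have l5 := (pos_iff_of_sameLine (u' := vM) (v' := vR) (by decide +kernel) q).1 hM
  rcases lt_trichotomy (side (evPt vK) (evPt vR) q) 0 with h | h | h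
  · have l6 := (neg_iff_of_sameLine (u' := vR) (v' := vL) (by decide +kernel) q).1 h
    obtain ⟨w, hw, e⟩ := exists_comb (t := cellFour) (q := q) l6 (hKL.resolve_left h.not_gt) l5
    exact ⟨_, w, .four, hw, e⟩
  · have l6 : side (evPt vR) (evPt vL) q = 0 := by
      apply le_antisymm
      · by_contra! h'
        exact ((neg_iff_of_sameLine (u := vK) (v := vR) (by decide +kernel) q).2 h').ne h
      · by_contra! h'
        have := (neg_iff_of_sameLine (u' := vK) (v' := vR) (by decide +kernel) q).1 h'
        exact this.ne' h
    obtain ⟨w, hw, e⟩ := exists_comb_segment l6 (hKL.resolve_left h.not_gt) l5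
    exact ⟨_, w, .seg_three, hw, e⟩
  · rcases lt_trichotomy (side (evPt vX) (evPt (vA 2)) q) 0 with h' | h' | h'
    · have l7 : 0 < side (evPt (vA 2)) (evPt vX) q := by rw [side_swap]; linarith
      rcases lt_trichotomy (side (evPt vX) (evPt vR) q) 0 with h2 | h2 | h2
      · have l8 : 0 < side (evPt vR) (evPt vX) q := by rw [side_swap]; linarith
        obtain ⟨w, hw, e⟩ := exists_comb (t := cellThreeLeft) (q := q) l3 h l8
        exact ⟨_, w, .three_left, hw, e⟩
      · obtain ⟨w, hw, e⟩ := exists_comb_segment h2 l4 l7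
        exact ⟨_, w, .three_mid, hw, e⟩
      · obtain ⟨w, hw, e⟩ := exists_comb (t := cellThreeRight) (q := q) h2 l4 l7
        exact ⟨_, w, .three_right, hw, e⟩
    · obtain ⟨w, hw, e⟩ := exists_comb_segment h' l2 l1
      exact ⟨_, w, .seg_two, hw, e⟩
    · obtain ⟨w, hw, e⟩ := exists_comb (t := cellTwo) (q := q) l1 h' l2
      exact ⟨_, w, .two, hw, e⟩

theorem continuous_side (u v : ℝ × ℝ) : Continuous (side u v) := by
  unfold side; fun_prop

theorem isOpen_dartInt : IsOpen dartInt := by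
  refine (isOpen_lt continuous_const (continuous_side _ _)).inter
    ((isOpen_lt continuous_const (continuous_side _ _)).inter
    ((isOpen_lt continuous_const (continuous_side _ _)).union
      (isOpen_lt continuous_const (continuous_side _ _))))

theorem nonneg_of_mem_convexHull {z a : ℂ} (ha : a ≠ 0) {u v : Pt} {t : Tri}
    (h : nonnegOn u v t = true) {q : ℝ × ℝ} (hm : emb z a q ∈ convexHull ℝ
      {emb z a (evPt t.1), emb z a (evPt t.2.1), emb z a (evPt t.2.2)}) :
    0 ≤ side (evPt u) (evPt v) q := by
  simp only [nonnegOn, Bool.and_eq_true] at h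
  obtain ⟨⟨h1, h2⟩, h3⟩ := h
  have hsub := convexHull_min
    (s := {emb z a (evPt t.1), emb z a (evPt t.2.1), emb z a (evPt t.2.2)})
    (t := {x | 0 ≤ crossProd (emb z a (evPt v) - emb z a (evPt u)) (x - emb z a (evPt u))})
    (by
      rintro x (rfl | rfl | rfl) <;> rw [mem_ofPred_eq, crossProd_emb, side_evPt] <;>
        exact mul_nonneg (areaUnit_pos ha).le (ev_nonneg (by assumption)))
    (convex_crossProd_nonneg _ _)
  have := hsub hm
  rw [mem_ofPred_eq, crossProd_emb] at this
  exact nonneg_of_mul_nonneg_right this (areaUnit_pos ha)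

theorem nonneg_of_mem_dart {z a : ℂ} (ha : a ≠ 0) {u v : Pt}
    (h1 : nonnegOn u v (vA 1, vK, vR) = true) (h2 : nonnegOn u v (vR, vL, vM) = true)
    {q : ℝ × ℝ} (hq : emb z a q ∈ dart z a) : 0 ≤ side (evPt u) (evPt v) q := by
  rw [dart_eq] at hq
  exact hq.elim (nonneg_of_mem_convexHull ha h1) (nonneg_of_mem_convexHull ha h2)

/-- The sides `KL` and `LM` of the closed quadrilateral, which meet in a reflex angle. -/
theorem nonneg_or_nonneg_of_mem_dart {z a : ℂ} (ha : a ≠ 0) {q : ℝ × ℝ}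
    (h : emb z a q ∈ dart z a) :
    0 ≤ side (evPt vK) (evPt vR) q ∨ 0 ≤ side (evPt vL) (evPt vM) q := by
  rw [dart_eq] at h
  exact h.imp (nonneg_of_mem_convexHull (t := (vA 1, vK, vR)) ha (by decide +kernel))
    (nonneg_of_mem_convexHull (t := (vR, vL, vM)) ha (by decide +kernel))

theorem continuous_emb (z a : ℂ) : Continuous (emb z a) := by
  unfold emb; fun_prop

/-- A point of the interior of the quadrilateral can be moved in any direction. -/
theorem exists_move {z a : ℂ} {q : ℝ × ℝ} (h : emb z a q ∈ interior (dart z a)) (d : ℝ × ℝ) :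
    ∃ t : ℝ, 0 < t ∧ emb z a (q + t • d) ∈ dart z a := by
  have hc : Continuous fun t : ℝ => emb z a (q + t • d) :=
    (continuous_emb z a).comp (by fun_prop)
  have h0 : ∀ᶠ t in 𝓝 (0 : ℝ), emb z a (q + t • d) ∈ dart z a := by
    apply hc.continuousAt.eventually_mem
    simpa using mem_interior_iff_mem_nhds.1 h
  obtain ⟨t, ht, ht0⟩ := ((h0.filter_mono nhdsWithin_le_nhds).and
    (self_mem_nhdsWithin (s := Ioi (0 : ℝ)))).exists
  exact ⟨t, ht0, ht⟩

theorem side_move (u v q : ℝ × ℝ) (t : ℝ) (x y : ℝ × ℝ) :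
    side u v (q + t • (y - x)) = side u v q + t * (side u v y - side u v x) := by
  simp [side]; ring

theorem mem_dart_of_mem_dartInt {z a : ℂ} {q : ℝ × ℝ} (hq : q ∈ dartInt) : emb z a q ∈ dart z a := by
  obtain ⟨t, w, ht, hw, rfl⟩ := exists_cell hq
  have hw := hw.isWeight
  rw [dart_eq]
  set H₁ := convexHull ℝ {emb z a (evPt (vA 1)), emb z a (evPt vK), emb z a (evPt vR)} with hH₁
  set H₂ := convexHull ℝ {emb z a (evPt vR), emb z a (evPt vL), emb z a (evPt vM)} with hH₂
  have c₁ : Convex ℝ H₁ := convex_convexHull ℝ _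
  have c₂ : Convex ℝ H₂ := convex_convexHull ℝ _
  have hO : emb z a (evPt (vA 1)) ∈ H₁ := subset_convexHull ℝ _ (by simp)
  have hK : emb z a (evPt vK) ∈ H₁ := subset_convexHull ℝ _ (by simp)
  have hR : emb z a (evPt vR) ∈ H₁ := subset_convexHull ℝ _ (by simp)
  have hR' : emb z a (evPt vR) ∈ H₂ := subset_convexHull ℝ _ (by simp)
  have hL : emb z a (evPt vL) ∈ H₂ := subset_convexHull ℝ _ (by simp)
  have hM : emb z a (evPt vM) ∈ H₂ := subset_convexHull ℝ _ (by simp)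
  have hX : emb z a (evPt vX) ∈ H₁ :=
    emb_mem_of_isNonneg c₁ (T := (vA 1, vK, vR)) (by decide +kernel) (by decide +kernel)
      (by decide +kernel) (by decide +kernel) hO hK hR
  have hA : emb z a (evPt (vA 2)) ∈ H₁ :=
    emb_mem_of_isNonneg c₁ (T := (vA 1, vK, vR)) (by decide +kernel) (by decide +kernel)
      (by decide +kernel) (by decide +kernel) hO hK hR
  cases ht
  · exact .inl (emb_comb_mem c₁ hw hO hX hA)
  · exact .inl (emb_comb_mem c₁ hw hX hK hR)
  · exact .inl (emb_comb_mem c₁ hw hX hR hA)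
  · exact .inl (emb_comb_mem c₁ hw hX hR hR)
  · exact .inr (emb_comb_mem c₂ hw hR' hL hM)
  · exact .inl (emb_comb_mem c₁ hw hX hA hA)
  · exact .inr (emb_comb_mem c₂ hw hR' hL hL)

theorem emb_mem_interior_dart {z a : ℂ} (ha : a ≠ 0) {q : ℝ × ℝ} :
    emb z a q ∈ interior (dart z a) ↔ q ∈ dartInt := by
  constructor
  · intro h
    -- if a move which decreases a side keeps it nonnegative, then it was positive
    have neg : ∀ u v x y : Pt, isPos (side u v x - side u v y) = true → ∀ t : ℝ, 0 < t →
        0 ≤ side (evPt u) (evPt v) (q + t • (evPt y - evPt x)) →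
        0 < side (evPt u) (evPt v) q := by
      intro u v x y hp t ht h
      have hp := ev_pos hp
      rw [map_sub] at hp
      rw [side_move, side_evPt, side_evPt] at h
      nlinarith
    refine ⟨?_, ?_, ?_⟩
    · obtain ⟨t, ht, hm⟩ := exists_move h (evPt (vA 1) - evPt vM)
      exact neg _ _ _ _ (by decide +kernel) t ht
        (nonneg_of_mem_dart ha (by decide +kernel) (by decide +kernel) hm)
    · obtain ⟨t, ht, hm⟩ := exists_move h (evPt (vA 1) - evPt vK)
      exact neg _ _ _ _ (by decide +kernel) t ht
        (nonneg_of_mem_dart ha (by decide +kernel) (by decide +kernel) hm)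
    · obtain ⟨t, ht, hm⟩ := exists_move h (evPt vL - evPt (vA 1))
      exact (nonneg_or_nonneg_of_mem_dart ha hm).imp (neg _ _ _ _ (by decide +kernel) t ht)
        (neg _ _ _ _ (by decide +kernel) t ht)
  · intro h
    refine mem_interior.2 ⟨coord z a ⁻¹' dartInt, fun x hx => ?_,
      isOpen_dartInt.preimage (continuous_coord z a), by rwa [mem_preimage, coord_emb ha]⟩
    rw [← emb_coord ha x]
    exact mem_dart_of_mem_dartInt hx

theorem mem_interior_dart {z a : ℂ} (ha : a ≠ 0) {x : ℂ} :
    x ∈ interior (dart z a) ↔ coord z a x ∈ dartInt := by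
  rw [← emb_mem_interior_dart ha, emb_coord ha]

/-- The images of the open quadrilateral under rotations by a multiple of `π / 4` are disjoint. -/
theorem rotate_not_mem {q : ℝ × ℝ} (hq : q ∈ dartInt) {k : ℕ} (hk : k < 8) (hk0 : k ≠ 0) :
    (rotate √2)^[k] q ∉ dartInt := by
  obtain ⟨t, w, ht, hw, rfl⟩ := exists_cell hq
  rw [rotate_iterate_comb]
  have h : outsideDart id (t.map (rotate zs)^[k]) = true := by
    clear hq
    revert k
    cases ht <;> decide +kernel
  simp only [outsideDart, Bool.or_eq_true, Bool.and_eq_true, id] at h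
  rintro ⟨h1, h2, h3⟩
  have hw := hw.isWeight
  rcases h with (h | h) | h
  · have := nonneg_of_nonnegOn h hw
    rw [side_swap] at this; linarith
  · have := nonneg_of_nonnegOn h hw
    rw [side_swap] at this; linarith
  · have e1 := nonneg_of_nonnegOn h.1 hw
    have e2 := nonneg_of_nonnegOn h.2 hw
    rw [side_swap] at e1 e2
    rcases h3 with h3 | h3 <;> linarith

theorem rotate_unique {z a : ℂ} (ha : a ≠ 0) {x y : ℂ} (hx : x ∈ interior (dart z a))
    (hy : y ∈ interior (dart z a)) {k : ℕ} (h : y = z + rot8 ^ k * (x - z)) : y = x := by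
  have e : rot8 ^ k = rot8 ^ (k % 8) := by
    conv_lhs => rw [← Nat.div_add_mod k 8]
    rw [pow_add, pow_mul, rot8_pow_eight, one_pow, one_mul]
  rw [e] at h
  by_cases hk : k % 8 = 0
  · rw [h, hk]; ring
  · exfalso
    rw [← emb_coord ha x, ← emb_rotate_iterate] at h
    rw [h, emb_mem_interior_dart ha] at hy
    rw [mem_interior_dart ha] at hx
    exact rotate_not_mem hx (Nat.mod_lt _ (by norm_num)) hk hy

theorem mem_reducedMap {z a : ℂ} (ha : a ≠ 0) {x y : ℂ} : y ∈ reducedMap z a x ↔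
    x ∈ interior (dart z a) ∧ y ∈ interior (dart z a) ∧
      ∃ w ∈ outerBilliard (octagon z a) x, ∃ k : ℕ, y = z + rot8 ^ k * (w - z) := by
  constructor
  · rintro ⟨h, rfl⟩
    exact ⟨h.1, h.2.choose_spec.1⟩
  · rintro ⟨hx, hy, w, hw, k, hk⟩
    have h' : ∃! y, y ∈ interior (dart z a) ∧
        ∃ w ∈ outerBilliard (octagon z a) x, ∃ k : ℕ, y = z + rot8 ^ k * (w - z) := by
      refine ⟨y, ⟨hy, w, hw, k, hk⟩, ?_⟩
      rintro y' ⟨hy', w', hw', k', hk'⟩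
      obtain rfl := Part.mem_unique hw hw'
      refine rotate_unique ha hy hy' (k := k' + 7 * k) ?_
      rw [hk, pow_add, mul_assoc, hk']
      have := rotate_rotate_inv z w k
      linear_combination -rot8 ^ k' * this
    refine ⟨⟨hx, h'⟩, ?_⟩
    exact h'.unique h'.choose_spec.1 ⟨hy, w, hw, k, hk⟩

theorem side_neg_of_mem_dartInt {q : ℝ × ℝ} (hq : q ∈ dartInt) :
    side (evPt (vA 1)) (evPt (vA 2)) q < 0 :=
  (neg_iff_of_sameLine (by decide +kernel) q).2 hq.2.1

theorem reducedMap_of_inPiece {z a : ℂ} (ha : a ≠ 0) {k : ℕ} (hk : k < 8) {t : Tri}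
    (h : inPiece k t = true) {w : ℝ × ℝ × ℝ} (hw : IsPosWeight w) :
    reducedMap z a (emb z a (comb w t)) =
      Part.some (emb z a (comb w (t.map (branch zs k)))) := by
  simp only [inPiece, Bool.and_eq_true, List.all_eq_true, List.mem_range, Bool.or_eq_true,
    beq_iff_eq] at h
  obtain ⟨⟨h1, h2⟩, h3⟩ := h
  have d2 := mem_dartInt_of_insideDart h2 hw
  rw [Part.eq_some_iff, mem_reducedMap ha]
  refine ⟨(emb_mem_interior_dart ha).2 d2,
    (emb_mem_interior_dart ha).2 (mem_dartInt_of_insideDart h3 hw), _,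
    mem_outerBilliard_octagon ha (side_neg_of_mem_dartInt d2) (k := k)
      (fun j hj hjk => pos_of_posOn ((h1 j hj).resolve_left hjk) hw), 9 - k, ?_⟩
  have e : rot8 ^ (9 - k) * rot8 ^ k = rot8 := by
    rw [← pow_add, show 9 - k + k = 8 + 1 by omega, pow_add, rot8_pow_eight, one_mul, pow_one]
  have e2 : emb z a (comb w (t.map (branch zs k))) =
      z + 2 * a * rot8 - (emb z a ((rotate √2)^[9 - k] (comb w t)) - z) := by
    rw [← branch_comb hw.sum]
    simp [branch, emb]; ring
  rw [e2, emb_rotate_iterate, octVertex]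
  linear_combination -2 * a * e

theorem reducedMap_of_onSingular {z a : ℂ} (ha : a ≠ 0) {k : ℕ} {t : Tri}
    (h : onSingular k t = true) {w : ℝ × ℝ × ℝ} (hw : IsPosWeight w) :
    reducedMap z a (emb z a (comb w t)) = Part.none := by
  simp only [onSingular, Bool.and_eq_true, List.all_eq_true, List.mem_range] at h
  rw [Part.eq_none_iff]
  intro y hy
  rw [mem_reducedMap ha] at hy
  obtain ⟨-, -, w', hw', -⟩ := hy
  rw [mem_outerBilliard] at hw'
  obtain ⟨-, q, -, hu, -⟩ := hw'
  have e1 := hu _ (isRightTangentPoint_octVertex ha (k := k)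
    (fun j hj => nonneg_of_nonnegOn (h j hj).1 hw.isWeight))
  have e2 := hu _ (isRightTangentPoint_octVertex ha (k := k + 1)
    (fun j hj => nonneg_of_nonnegOn (h j hj).2 hw.isWeight))
  have e := e1.trans e2.symm
  have e3 : a * rot8 ^ k * (rot8 - 1) = 0 := by
    simp only [octVertex] at e
    linear_combination -e
  rcases mul_eq_zero.1 e3 with h0 | h0
  · exact mul_ne_zero ha (pow_ne_zero _ rot8_ne_zero) h0
  · have := congrArg Complex.im h0
    simp [rot8_eq] at this

/-! ### Iterates and first returns of partial maps -/

section PartialMaps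

variable {α : Type*} {f : α →. α}

theorem mem_iterPart_succ' {n : ℕ} {x y : α} :
    y ∈ iterPart f (n + 1) x ↔ ∃ w ∈ iterPart f n x, y ∈ f w := by
  rw [iterPart, Function.iterate_succ_apply']
  exact Part.mem_bind_iff

@[simp] theorem mem_iterPart_zero {x y : α} : y ∈ iterPart f 0 x ↔ y = x :=
  Part.mem_some_iff

theorem mem_iterPart_add {m n : ℕ} {x y : α} :
    y ∈ iterPart f (m + n) x ↔ ∃ w ∈ iterPart f m x, y ∈ iterPart f n w := by
  induction n generalizing y with
  | zero => simp
  | succ n ih =>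
    rw [← add_assoc, mem_iterPart_succ']
    simp only [ih, mem_iterPart_succ']
    constructor
    · rintro ⟨w, ⟨v, hv, hw⟩, hy⟩; exact ⟨v, hv, w, hw, hy⟩
    · rintro ⟨v, hv, w, hw, hy⟩; exact ⟨w, ⟨v, hv, hw⟩, hy⟩

theorem mem_iterPart_one {x y : α} : y ∈ iterPart f 1 x ↔ y ∈ f x := by
  rw [show 1 = 0 + 1 from rfl, mem_iterPart_succ']; simp

theorem mem_iterPart_succ {n : ℕ} {x y : α} :
    y ∈ iterPart f (n + 1) x ↔ ∃ w ∈ f x, y ∈ iterPart f n w := by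
  rw [add_comm, mem_iterPart_add]; simp only [mem_iterPart_one]

theorem mem_firstReturn {S : Set α} {x y : α} : y ∈ firstReturn f S x ↔
    ∃ n, 0 < n ∧ y ∈ iterPart f n x ∧ y ∈ S ∧
      ∀ m, 0 < m → m < n → ∀ v ∈ iterPart f m x, v ∉ S := by
  classical
  constructor
  · rintro ⟨h, rfl⟩
    have h' := h
    refine ⟨Nat.find h', (Nat.find_spec h').1, ⟨(Nat.find_spec h').2.choose, rfl⟩, ?_, ?_⟩
    · exact (Nat.find_spec h').2.choose_spec
    · rintro m hm0 hm v ⟨hd, rfl⟩ hv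
      exact Nat.find_min h' hm ⟨hm0, hd, hv⟩
  · rintro ⟨n, hn, ⟨hd, hy⟩, hS, hmin⟩
    have h' : ∃ n : ℕ, 0 < n ∧ ∃ h : (iterPart f n x).Dom, (iterPart f n x).get h ∈ S :=
      ⟨n, hn, hd, hy ▸ hS⟩
    refine ⟨h', ?_⟩
    have e : Nat.find h' = n := by
      rw [Nat.find_eq_iff]
      exact ⟨⟨hn, hd, hy ▸ hS⟩, fun m hm ⟨h0, hd, hv⟩ => hmin m h0 hm _ ⟨hd, rfl⟩ hv⟩
    subst hy
    simp only [firstReturn]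
    congr!

theorem firstReturn_eq_none {S : Set α} {x : α} (h : f x = Part.none) :
    firstReturn f S x = Part.none := by
  rw [Part.eq_none_iff]
  intro y hy
  obtain ⟨n, hn, hy, -⟩ := mem_firstReturn.1 hy
  obtain ⟨n, rfl⟩ := Nat.exists_eq_succ_of_ne_zero hn.ne'
  obtain ⟨w, hw, -⟩ := mem_iterPart_succ.1 hy
  rw [h] at hw
  exact Part.notMem_none _ hw

theorem firstReturn_eq_some {S : Set α} {x y : α} (h : f x = Part.some y) (hy : y ∈ S) :
    firstReturn f S x = Part.some y := by
  rw [Part.eq_some_iff, mem_firstReturn]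
  refine ⟨1, one_pos, ?_, hy, fun m h0 h1 => by omega⟩
  rw [mem_iterPart_one, h]; exact Part.mem_some y

/-- A point which the first step takes outside `S` has the same first return as its image. -/
theorem firstReturn_eq_of_notMem {S : Set α} {x y : α} (h : f x = Part.some y) (hy : y ∉ S) :
    firstReturn f S x = firstReturn f S y := by
  have hs : ∀ n v, v ∈ iterPart f (n + 1) x ↔ v ∈ iterPart f n y := by
    intro n v
    rw [mem_iterPart_succ, h]
    simp
  ext v
  rw [mem_firstReturn, mem_firstReturn]
  constructor
  · rintro ⟨n, hn, hv, hS, hmin⟩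
    obtain ⟨n, rfl⟩ := Nat.exists_eq_succ_of_ne_zero hn.ne'
    rw [Nat.succ_eq_add_one, hs] at hv
    refine ⟨n, ?_, hv, hS,
      fun m h0 hm u hu => hmin (m + 1) (by omega) (by omega) u ((hs _ _).2 hu)⟩
    rcases Nat.eq_zero_or_pos n with rfl | h0
    · rw [mem_iterPart_zero] at hv
      exact absurd (hv ▸ hS) hy
    · exact h0
  · rintro ⟨n, hn, hv, hS, hmin⟩
    refine ⟨n + 1, by omega, (hs _ _).2 hv, hS, fun m h0 hm u hu => ?_⟩
    obtain ⟨m, rfl⟩ := Nat.exists_eq_succ_of_ne_zero h0.ne'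
    rw [Nat.succ_eq_add_one, hs] at hu
    rcases Nat.eq_zero_or_pos m with rfl | h1
    · rw [mem_iterPart_zero] at hu
      exact hu ▸ hy
    · exact hmin m h1 (by omega) u hu

end PartialMaps

/-! ### The renormalization -/

/-- The complex number by which the linear part of the renormalization multiplies. -/
noncomputable def renormFactor : ℂ := ((3 - 2 * √2 : ℝ) : ℂ) * rot8 ^ 6

theorem ratio_pos : 0 < 3 - 2 * √2 := by nlinarith [sqrtTwo_sq, Real.sqrt_nonneg 2]

theorem ratio_lt_one : 3 - 2 * √2 < 1 := by
  have : 1 < √2 := Real.lt_sqrt_of_sq_lt (by norm_num)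
  linarith

theorem norm_renormFactor : ‖renormFactor‖ = 3 - 2 * √2 := by
  have h : ‖rot8‖ = 1 := by
    rw [← sq_eq_sq₀ (norm_nonneg _) zero_le_one, ← Complex.normSq_eq_norm_sq, normSq_rot8, one_pow]
  rw [renormFactor, norm_mul, norm_pow, h, Complex.norm_real, one_pow, mul_one,
    Real.norm_of_nonneg ratio_pos.le]

theorem renormFactor_ne_zero : renormFactor ≠ 0 := by
  rw [← norm_pos_iff, norm_renormFactor]; exact ratio_pos

/-- The renormalization as a map of the plane. -/
noncomputable def renormMap (z a : ℂ) : ℂ →ᵃ[ℝ] ℂ where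
  toFun w := dartL z a + renormFactor * (w - dartO z a)
  linear := LinearMap.mulLeft ℝ renormFactor
  map_vadd' p v := by simp; ring

theorem renormMap_apply (z a w : ℂ) :
    renormMap z a w = dartL z a + renormFactor * (w - dartO z a) := rfl

theorem dist_renormMap (z a x y : ℂ) :
    dist (renormMap z a x) (renormMap z a y) = (3 - 2 * √2) * dist x y := by
  rw [dist_eq_norm, dist_eq_norm, renormMap_apply, renormMap_apply, ← norm_renormFactor, ← norm_mul]
  congr 1; ring

theorem interior_image_renormMap (z a : ℂ) (S : Set ℂ) :
    interior (renormMap z a '' S) = renormMap z a '' interior S := by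
  let e : ℂ ≃ₜ ℂ :=
    { toFun := renormMap z a
      invFun := fun w => dartO z a + (w - dartL z a) / renormFactor
      left_inv := fun w => by
        have := renormFactor_ne_zero
        rw [renormMap_apply]; field_simp; ring
      right_inv := fun w => by
        have := renormFactor_ne_zero
        rw [renormMap_apply]; field_simp; ring
      continuous_toFun := by
        change Continuous fun w => dartL z a + renormFactor * (w - dartO z a)
        fun_prop
      continuous_invFun := by fun_prop }
  exact (e.image_interior S).symm

theorem renormMap_emb (z a : ℂ) (q : ℝ × ℝ) :
    renormMap z a (emb z a q) = emb z a (renorm √2 q) := by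
  have hr : renorm √2 q = (-4 + (3 - 2 * √2) * ((rotate √2)^[6] (q.1, q.2 - 2)).1,
    2 + 2 * √2 + (3 - 2 * √2) * ((rotate √2)^[6] (q.1, q.2 - 2)).2) := rfl
  rw [hr]
  have e := emb_rotate_iterate z a 6 (q.1, q.2 - 2)
  generalize (rotate √2)^[6] (q.1, q.2 - 2) = p at e ⊢
  have hO : evPt (vA 1) = (0, 2) := by
    ext <;> simp [evPt, vA, rotate, ev_apply]
  have hL : evPt vL = (-4, 2 + 2 * √2) := by
    ext <;> simp [evPt, vL, vR, vA, rotate, ev_apply, zs]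
  rw [renormMap_apply, dartL_eq, dartO_eq, renormFactor, hO, hL]
  simp only [emb] at e ⊢
  push_cast at e ⊢
  linear_combination (-(3 - 2 * ((√2 : ℝ) : ℂ))) * e

theorem side_renorm {R : Type*} [CommRing R] (s : R) (u v p : R × R) :
    side (renorm s u) (renorm s v) (renorm s p) = (3 - 2 * s) ^ 2 * side u v p := by
  have h : ∀ u v p : R × R, side (rotate s u) (rotate s v) (rotate s p) = side u v p := by
    intro u v p; simp only [side, rotate]; ring
  have h6 : ∀ n, ∀ u v p : R × R,
      side ((rotate s)^[n] u) ((rotate s)^[n] v) ((rotate s)^[n] p) = side u v p := by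
    intro n
    induction n with
    | zero => intro u v p; rfl
    | succ n ih => intro u v p; simp only [Function.iterate_succ_apply, ih, h]
  have e := h6 6 (u.1, u.2 - 2) (v.1, v.2 - 2) (p.1, p.2 - 2)
  simp only [renorm]
  generalize (rotate s)^[6] (u.1, u.2 - 2) = u' at *
  generalize (rotate s)^[6] (v.1, v.2 - 2) = v' at *
  generalize (rotate s)^[6] (p.1, p.2 - 2) = p' at *
  simp only [side] at e ⊢
  linear_combination (3 - 2 * s) ^ 2 * e

theorem emb_notMem_of_outsideDart {z a : ℂ} (ha : a ≠ 0) {t : Tri}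
    (h : outsideDart (renorm zs) t = true) {w : ℝ × ℝ × ℝ} (hw : IsPosWeight w) :
    emb z a (comb w t) ∉ interior (renormMap z a '' dart z a) := by
  rw [interior_image_renormMap]
  rintro ⟨x, hx, e⟩
  rw [← emb_coord ha x, renormMap_emb] at e
  rw [mem_interior_dart ha] at hx
  generalize coord z a x = q at *
  have e := emb_injective ha e
  have hw := hw.isWeight
  have key : ∀ u v : Pt, nonnegOn (renorm zs u) (renorm zs v) t = true →
      0 < side (evPt v) (evPt u) q → False := by
    intro u v h h'
    have := nonneg_of_nonnegOn h hw
    rw [← e, ← renorm_evPt, ← renorm_evPt, side_renorm, side_swap] at this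
    have := mul_pos (pow_pos ratio_pos 2) h'
    linarith
  simp only [outsideDart, Bool.or_eq_true, Bool.and_eq_true] at h
  obtain ⟨h1, h2, h3⟩ := hx
  rcases h with (h | h) | h
  · exact key _ _ h h1
  · exact key _ _ h h2
  · exact h3.elim (key _ _ h.1) (key _ _ h.2)

theorem firstReturn_of_returnCheck {z a : ℂ} (ha : a ≠ 0) {w : ℝ × ℝ × ℝ} (hw : IsPosWeight w)
    {S : Set ℂ} (hS : S = interior (renormMap z a '' dart z a))
    {l : List ℕ} (hl : ∀ k ∈ l, k < 8) {t t' : Tri} (h : returnCheck l t t' = true)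
    (ht' : emb z a (comb w t') ∈ S) :
    firstReturn (reducedMap z a) S (emb z a (comb w t)) = Part.some (emb z a (comb w t')) := by
  induction l generalizing t with
  | nil => simp [returnCheck] at h
  | cons k l ih =>
    have hk := hl k (by simp)
    cases l with
    | nil =>
      simp only [returnCheck, Bool.and_eq_true, decide_eq_true_eq] at h
      rw [← h.2] at ht' ⊢
      exact firstReturn_eq_some (reducedMap_of_inPiece ha hk h.1 hw) ht'
    | cons k' l =>
      simp only [returnCheck, Bool.and_eq_true] at h
      rw [firstReturn_eq_of_notMem (reducedMap_of_inPiece ha hk h.1.1 hw)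
        (hS ▸ emb_notMem_of_outsideDart ha h.1.2 hw)]
      exact ih (fun j hj => hl j (List.mem_cons_of_mem _ hj)) h.2

theorem firstReturn_of_stopCheck {z a : ℂ} (ha : a ≠ 0) {w : ℝ × ℝ × ℝ} (hw : IsPosWeight w)
    {S : Set ℂ} (hS : S = interior (renormMap z a '' dart z a)) {m : ℕ}
    {l : List ℕ} (hl : ∀ k ∈ l, k < 8) {t : Tri} (h : stopCheck m l t = true) :
    firstReturn (reducedMap z a) S (emb z a (comb w t)) = Part.none := by
  induction l generalizing t with
  | nil =>
    exact firstReturn_eq_none (reducedMap_of_onSingular ha h hw)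
  | cons k l ih =>
    have hk := hl k (by simp)
    simp only [stopCheck, Bool.and_eq_true] at h
    rw [firstReturn_eq_of_notMem (reducedMap_of_inPiece ha hk h.1.1 hw)
      (hS ▸ emb_notMem_of_outsideDart ha h.1.2 hw)]
    exact ih (fun j hj => hl j (List.mem_cons_of_mem _ hj)) h.2

/-- On a cell where the reduced map is the branch `k`, the conjugacy follows from an itinerary `l`
of the renormalized cell. -/
theorem conj_of_returnCheck {z a : ℂ} (ha : a ≠ 0) {w : ℝ × ℝ × ℝ} (hw : IsPosWeight w)
    {k : ℕ} (hk : k < 8) {l : List ℕ} (hl : ∀ k ∈ l, k < 8) {t : Tri} (h : inPiece k t = true)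
    (hr : returnCheck l (t.map (renorm zs)) ((t.map (branch zs k)).map (renorm zs)) = true) :
    (reducedMap z a (emb z a (comb w t))).map (renormMap z a) =
      firstReturn (reducedMap z a) (interior (renormMap z a '' dart z a))
        (renormMap z a (emb z a (comb w t))) := by
  have hi : emb z a (comb w (t.map (branch zs k))) ∈ interior (dart z a) := by
    rw [emb_mem_interior_dart ha]
    refine mem_dartInt_of_insideDart ?_ hw
    simp only [inPiece, Bool.and_eq_true] at h
    exact h.2
  rw [reducedMap_of_inPiece ha hk h hw, Part.map_some, renormMap_emb, renorm_comb hw.sum,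
    renormMap_emb, renorm_comb hw.sum, firstReturn_of_returnCheck ha hw rfl hl hr]
  rw [interior_image_renormMap, ← renorm_comb hw.sum, ← renormMap_emb]
  exact mem_image_of_mem _ hi

/-- On a segment where the reduced map is undefined, the orbits of the renormalized segment reach
another such segment before they return. -/
theorem conj_of_stopCheck {z a : ℂ} (ha : a ≠ 0) {w : ℝ × ℝ × ℝ} (hw : IsPosWeight w)
    {k : ℕ} {l : List ℕ} (hl : ∀ k ∈ l, k < 8) {t : Tri} (h : onSingular k t = true)
    (hr : stopCheck k l (t.map (renorm zs)) = true) :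
    (reducedMap z a (emb z a (comb w t))).map (renormMap z a) =
      firstReturn (reducedMap z a) (interior (renormMap z a '' dart z a))
        (renormMap z a (emb z a (comb w t))) := by
  rw [reducedMap_of_onSingular ha h hw, Part.map_none, renormMap_emb, renorm_comb hw.sum,
    firstReturn_of_stopCheck ha hw rfl hl hr]

/-- The image of the quadrilateral under the renormalization lies in the triangle `OKR`. -/
theorem renormMap_image_subset (z a : ℂ) : renormMap z a '' dart z a ⊆ dart z a := by
  refine Subset.trans ?_ (b := convexHull ℝ
    {emb z a (evPt (vA 1)), emb z a (evPt vK), emb z a (evPt vR)}) ?_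
  swap
  · rw [dart_eq]; exact subset_union_left
  have hv : ∀ p : Pt, isNonneg (side (vA 1) vK (renorm zs p)) = true →
      isNonneg (side vK vR (renorm zs p)) = true → isNonneg (side vR (vA 1) (renorm zs p)) = true →
      renormMap z a (emb z a (evPt p)) ∈ convexHull ℝ
        {emb z a (evPt (vA 1)), emb z a (evPt vK), emb z a (evPt vR)} := by
    intro p h1 h2 h3
    rw [renormMap_emb, renorm_evPt]
    exact emb_mem_of_isNonneg (convex_convexHull ℝ _) (T := (vA 1, vK, vR)) (by decide +kernel)
      h1 h2 h3 (subset_convexHull ℝ _ (by simp)) (subset_convexHull ℝ _ (by simp))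
      (subset_convexHull ℝ _ (by simp))
  rw [dart_eq, image_union, AffineMap.image_convexHull, AffineMap.image_convexHull]
  refine union_subset (convexHull_min ?_ (convex_convexHull ℝ _))
    (convexHull_min ?_ (convex_convexHull ℝ _))
  · rintro _ ⟨_, rfl | rfl | rfl, rfl⟩ <;>
      exact hv _ (by decide +kernel) (by decide +kernel) (by decide +kernel)
  · rintro _ ⟨_, rfl | rfl | rfl, rfl⟩ <;>
      exact hv _ (by decide +kernel) (by decide +kernel) (by decide +kernel)

theorem isRenormalization_renormMap {z a : ℂ} (ha : a ≠ 0) :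
    IsRenormalization z a (renormMap z a) where
  contracting_similarity := ⟨_, ratio_pos, ratio_lt_one, dist_renormMap z a⟩
  image_subset := renormMap_image_subset z a
  conj := by
    intro x hx
    rw [mem_interior_dart ha] at hx
    rw [← emb_coord ha x]
    obtain ⟨t, w, ht, hw, e⟩ := exists_cell hx
    rw [← e]
    cases ht
    · exact conj_of_returnCheck ha hw (k := 2) (by norm_num)
        (l := [3, 3, 2, 2, 2, 2, 2, 3, 3, 4, 3, 4]) (by decide) (by decide +kernel)
        (by decide +kernel)
    · exact conj_of_returnCheck ha hw (k := 3) (by norm_num)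
        (l := [3, 3, 2, 2, 3, 3, 4, 3, 4]) (by decide) (by decide +kernel) (by decide +kernel)
    · exact conj_of_returnCheck ha hw (k := 3) (by norm_num)
        (l := [3, 3, 2, 2, 3, 3, 4, 3, 4]) (by decide) (by decide +kernel) (by decide +kernel)
    · exact conj_of_returnCheck ha hw (k := 3) (by norm_num)
        (l := [3, 3, 2, 2, 3, 3, 4, 3, 4]) (by decide) (by decide +kernel) (by decide +kernel)
    · exact conj_of_returnCheck ha hw (k := 4) (by norm_num)
        (l := [3, 4, 3, 4, 3, 4]) (by decide) (by decide +kernel) (by decide +kernel)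
    · exact conj_of_stopCheck ha hw (k := 2) (l := [3, 3, 2, 2]) (by decide) (by decide +kernel)
        (by decide +kernel)
    · exact conj_of_stopCheck ha hw (k := 3) (l := [3]) (by decide) (by decide +kernel)
        (by decide +kernel)

/-! ### The limit point and its orbit -/

/-- The fixed point of the renormalization. -/
noncomputable def center (z a : ℂ) : ℂ :=
  (dartL z a - renormFactor * dartO z a) / (1 - renormFactor)

theorem renormMap_center (z a : ℂ) : renormMap z a (center z a) = center z a := by
  have h : 1 - renormFactor ≠ 0 := by
    intro h
    have := norm_renormFactor
    rw [← sub_eq_zero.1 h, norm_one] at this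
    linarith [ratio_lt_one]
  rw [renormMap_apply, center]
  field_simp
  ring

theorem dist_renormMap_iterate (z a x y : ℂ) (n : ℕ) :
    dist ((renormMap z a)^[n] x) ((renormMap z a)^[n] y) = (3 - 2 * √2) ^ n * dist x y := by
  induction n with
  | zero => simp
  | succ n ih =>
    rw [Function.iterate_succ_apply', Function.iterate_succ_apply', dist_renormMap, ih]; ring

theorem renormMap_iterate_center (z a : ℂ) (n : ℕ) :
    (renormMap z a)^[n] (center z a) = center z a :=
  Function.iterate_fixed (renormMap_center z a) n

theorem isCompact_dart (z a : ℂ) : IsCompact (dart z a) :=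
  ((Set.toFinite _).isCompact_convexHull ℝ).union ((Set.toFinite _).isCompact_convexHull ℝ)

theorem tendsto_ratio_pow : Tendsto (fun n : ℕ => (3 - 2 * √2) ^ n) atTop (𝓝 0) :=
  tendsto_pow_atTop_nhds_zero_of_lt_one ratio_pos.le ratio_lt_one

theorem mapsTo_renormMap_iterate (z a : ℂ) (n : ℕ) :
    MapsTo (renormMap z a)^[n] (dart z a) (dart z a) :=
  MapsTo.iterate (mapsTo_iff_image_subset.2 (renormMap_image_subset z a)) n

theorem center_mem_dart (z a : ℂ) : center z a ∈ dart z a := by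
  have hO : dartO z a ∈ dart z a := .inl (subset_convexHull ℝ _ (by simp))
  refine (isCompact_dart z a).isClosed.mem_of_tendsto
    (f := fun n => (renormMap z a)^[n] (dartO z a)) (b := atTop) ?_
    (Eventually.of_forall fun n => mapsTo_renormMap_iterate z a n hO)
  rw [tendsto_iff_dist_tendsto_zero]
  have h := tendsto_ratio_pow.mul_const (dist (dartO z a) (center z a))
  rw [zero_mul] at h
  refine h.congr fun n => ?_
  rw [← dist_renormMap_iterate z a, renormMap_iterate_center]

theorem antitone_renormQuad (z a : ℂ) : Antitone (renormQuad z a (renormMap z a)) := by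
  refine antitone_nat_of_succ_le fun n => ?_
  rintro _ ⟨x, hx, rfl⟩
  exact ⟨renormMap z a x, renormMap_image_subset z a (mem_image_of_mem _ hx),
    (Function.iterate_succ_apply _ _ _).symm⟩

theorem center_mem_renormQuad (z a : ℂ) (i : ℕ) :
    center z a ∈ renormQuad z a (renormMap z a) i :=
  ⟨_, center_mem_dart z a, renormMap_iterate_center z a _⟩

theorem tendsto_of_mem_renormQuad {z a : ℂ} {x : ℕ → ℂ}
    (hx : ∀ i, x i ∈ renormQuad z a (renormMap z a) i) : Tendsto x atTop (𝓝 (center z a)) := by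
  rw [tendsto_iff_dist_tendsto_zero]
  have h := (tendsto_ratio_pow.comp (tendsto_add_atTop_nat 1)).mul_const
    (Metric.diam (dart z a))
  rw [zero_mul] at h
  refine squeeze_zero (fun _ => dist_nonneg) (fun i => ?_) h
  obtain ⟨y, hy, e⟩ := hx i
  rw [← e, ← renormMap_iterate_center z a (i + 1), dist_renormMap_iterate]
  exact mul_le_mul_of_nonneg_left
    (Metric.dist_le_diam_of_mem (isCompact_dart z a).isBounded hy (center_mem_dart z a))
    (pow_nonneg ratio_pos.le _)

theorem iInter_renormQuad (z a : ℂ) :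
    ⋂ i, renormQuad z a (renormMap z a) i = {center z a} := by
  refine Subset.antisymm (fun y hy => ?_) ?_
  · exact tendsto_nhds_unique tendsto_const_nhds
      (tendsto_of_mem_renormQuad (x := fun _ => y) (fun i => mem_iInter.1 hy i))
  · rw [singleton_subset_iff]
    exact mem_iInter.2 (center_mem_renormQuad z a)

/-- The triangle `OKM`, the convex hull of the quadrilateral. -/
def hull : Tri := (vA 1, vK, vM)

theorem exists_comb_of_mem_dart {z a : ℂ} (ha : a ≠ 0) {q : ℝ × ℝ} (h : emb z a q ∈ dart z a) :
    ∃ w, IsWeight w ∧ comb w hull = q := by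
  have h1 := nonneg_of_mem_dart ha (u := vA 1) (v := vK) (by decide +kernel) (by decide +kernel) h
  have h2 := nonneg_of_mem_dart ha (u := vK) (v := vM) (by decide +kernel) (by decide +kernel) h
  have h3 := nonneg_of_mem_dart ha (u := vM) (v := vA 1) (by decide +kernel) (by decide +kernel) h
  have h0 : 0 < side (evPt (vA 1)) (evPt vK) (evPt vM) := by
    rw [side_evPt]; exact ev_pos (by decide +kernel)
  obtain ⟨w, ws, hq, e1, e2, e3⟩ := exists_bary (q := q) h0
  exact ⟨w, ⟨nonneg_of_mul_nonneg_left (e1 ▸ h2) h0, nonneg_of_mul_nonneg_left (e2 ▸ h3) h0,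
    nonneg_of_mul_nonneg_left (e3 ▸ h1) h0, ws⟩, hq⟩

theorem exists_comb_center {z a : ℂ} (ha : a ≠ 0) : ∃ w, IsWeight w ∧
    center z a = emb z a (comb w ((hull.map (renorm zs)).map (renorm zs))) := by
  have h := center_mem_dart z a
  rw [← emb_coord ha (center z a)] at h
  obtain ⟨w, hw, e⟩ := exists_comb_of_mem_dart ha h
  refine ⟨w, hw, ?_⟩
  rw [← renorm_comb hw.sum, ← renorm_comb hw.sum, ← renormMap_emb, ← renormMap_emb, e,
    emb_coord ha, renormMap_center, renormMap_center]

/-- The image of the limit point under the reduced map is a different point, and the limit point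
is itself the image of some point. -/
theorem exists_reducedMap_center {z a : ℂ} (ha : a ≠ 0) :
    ∃ x y, x ≠ center z a ∧ y ≠ center z a ∧ y ∈ reducedMap z a (center z a) ∧
      center z a ∈ reducedMap z a x := by
  obtain ⟨w, hw, e⟩ := exists_comb_center ha
  -- `c` lies in the domain of the branch `3` and in the image of the branch `4`
  obtain ⟨w₁, hw₁, e₁⟩ := exists_comb (t := cellThreeLeft)
    (q := comb w ((hull.map (renorm zs)).map (renorm zs)))
    (pos_of_allPosOn (by decide +kernel) hw) (pos_of_allPosOn (by decide +kernel) hw)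
    (pos_of_allPosOn (by decide +kernel) hw)
  obtain ⟨w₂, hw₂, e₂⟩ := exists_comb (t := cellFour.map (branch zs 4))
    (q := comb w ((hull.map (renorm zs)).map (renorm zs)))
    (pos_of_allPosOn (by decide +kernel) hw) (pos_of_allPosOn (by decide +kernel) hw)
    (pos_of_allPosOn (by decide +kernel) hw)
  have h₁ := reducedMap_of_inPiece (z := z) ha (k := 3) (t := cellThreeLeft) (by norm_num)
    (by decide +kernel) hw₁
  have h₂ := reducedMap_of_inPiece (z := z) ha (k := 4) (t := cellFour) (by norm_num)
    (by decide +kernel) hw₂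
  rw [e₁, ← e] at h₁
  rw [e₂, ← e] at h₂
  have hne : emb z a (comb w₁ (cellThreeLeft.map (branch zs 3))) ≠ center z a := by
    rw [e, ← branch_comb hw₁.sum, e₁, branch_comb hw.sum]
    intro h
    have h := emb_injective ha h
    -- the line `OL` separates the two points
    have p1 := pos_of_allPosOn (u := vA 1) (v := vL)
      (t := Tri.map (branch zs 3) ((hull.map (renorm zs)).map (renorm zs)))
      (by decide +kernel) hw
    have p2 := pos_of_allPosOn (u := vL) (v := vA 1)
      (t := (hull.map (renorm zs)).map (renorm zs)) (by decide +kernel) hw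
    rw [h] at p1
    rw [side_swap] at p2
    linarith
  refine ⟨_, _, ?_, hne, h₁ ▸ Part.mem_some _, h₂ ▸ Part.mem_some _⟩
  intro h
  rw [h] at h₂
  exact hne (Part.some_inj.1 (h₁.symm.trans h₂))

/-- The renormalization carries orbits of the reduced map to orbits. -/
theorem exists_iterPart_renormMap {z a : ℂ} (ha : a ≠ 0) {n : ℕ} (hn : 0 < n) {x y : ℂ}
    (h : y ∈ iterPart (reducedMap z a) n x) :
    ∃ m, 0 < m ∧ renormMap z a y ∈ iterPart (reducedMap z a) m (renormMap z a x) := by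
  have step : ∀ x y, y ∈ reducedMap z a x →
      ∃ m, 0 < m ∧ renormMap z a y ∈ iterPart (reducedMap z a) m (renormMap z a x) := by
    intro x y h
    have h' := Part.mem_map (renormMap z a) h
    rw [(isRenormalization_renormMap ha).conj x ((mem_reducedMap ha).1 h).1] at h'
    obtain ⟨m, hm, h', -⟩ := mem_firstReturn.1 h'
    exact ⟨m, hm, h'⟩
  induction n, hn using Nat.le_induction generalizing y with
  | base => exact step x y (mem_iterPart_one.1 h)
  | succ n hn ih =>
    obtain ⟨v, hv, hy⟩ := mem_iterPart_succ'.1 h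
    obtain ⟨m, hm, h1⟩ := ih hv
    obtain ⟨m', -, h2⟩ := step v y hy
    exact ⟨m + m', by omega, mem_iterPart_add.2 ⟨_, h1, h2⟩⟩

theorem exists_iterPart_renormMap_iterate {z a : ℂ} (ha : a ≠ 0) {x y : ℂ}
    (h : y ∈ reducedMap z a x) (i : ℕ) : ∃ m, 0 < m ∧
      (renormMap z a)^[i] y ∈ iterPart (reducedMap z a) m ((renormMap z a)^[i] x) := by
  induction i with
  | zero => exact ⟨1, one_pos, mem_iterPart_one.2 h⟩
  | succ i ih =>
    obtain ⟨m, hm, h⟩ := ih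
    rw [Function.iterate_succ_apply', Function.iterate_succ_apply']
    exact exists_iterPart_renormMap ha hm h

theorem iterPart_outerBilliard_rotate {z a : ℂ} (k : ℕ) {n : ℕ} {x y : ℂ}
    (h : y ∈ iterPart (outerBilliard (octagon z a)) n x) :
    z + rot8 ^ k * (y - z) ∈ iterPart (outerBilliard (octagon z a)) n (z + rot8 ^ k * (x - z)) := by
  induction n generalizing y with
  | zero => rw [mem_iterPart_zero] at h ⊢; rw [h]
  | succ n ih =>
    rw [mem_iterPart_succ'] at h ⊢
    obtain ⟨v, hv, hy⟩ := h
    exact ⟨_, ih hv, outerBilliard_rotate k hy⟩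

/-- Orbits of the reduced map are orbits of the outer billiard map up to rotations. -/
theorem exists_iterPart_outerBilliard {z a : ℂ} (ha : a ≠ 0) {n : ℕ} {x y : ℂ}
    (h : y ∈ iterPart (reducedMap z a) n x) :
    ∃ k < 8, z + rot8 ^ k * (y - z) ∈ iterPart (outerBilliard (octagon z a)) n x := by
  suffices ∃ k : ℕ, z + rot8 ^ k * (y - z) ∈ iterPart (outerBilliard (octagon z a)) n x by
    obtain ⟨k, hk⟩ := this
    refine ⟨k % 8, Nat.mod_lt _ (by norm_num), ?_⟩
    rwa [← Nat.div_add_mod k 8, pow_add, pow_mul, rot8_pow_eight, one_pow, one_mul] at hk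
  induction n generalizing y with
  | zero => exact ⟨0, by rw [mem_iterPart_zero] at h ⊢; rw [h]; ring⟩
  | succ n ih =>
    obtain ⟨v, hv, hy⟩ := mem_iterPart_succ'.1 h
    obtain ⟨k, hk⟩ := ih hv
    obtain ⟨-, -, w, hw, j, rfl⟩ := (mem_reducedMap ha).1 hy
    refine ⟨7 * j + k, mem_iterPart_succ'.2 ⟨_, hk, ?_⟩⟩
    have := outerBilliard_rotate k hw
    convert this using 1
    rw [pow_add]
    linear_combination rot8 ^ k * rotate_rotate_inv z w j

theorem iterPart_outerBilliard_injective {γ : Set ℂ} {n : ℕ} {x x' y : ℂ}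
    (h : y ∈ iterPart (outerBilliard γ) n x) (h' : y ∈ iterPart (outerBilliard γ) n x') :
    x = x' := by
  induction n generalizing y with
  | zero => rw [mem_iterPart_zero] at h h'; rw [← h, ← h']
  | succ n ih =>
    obtain ⟨v, hv, hy⟩ := mem_iterPart_succ'.1 h
    obtain ⟨v', hv', hy'⟩ := mem_iterPart_succ'.1 h'
    obtain rfl := outerBilliard_injective hy hy'
    exact ih hv hv'

theorem renormMap_iterate_injective {z a x : ℂ} (hx : x ≠ center z a) :
    Function.Injective fun i => (renormMap z a)^[i] x := by
  intro i j h
  have e : ∀ n, dist ((renormMap z a)^[n] x) (center z a) =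
      (3 - 2 * √2) ^ n * dist x (center z a) := fun n => by
    rw [← dist_renormMap_iterate, renormMap_iterate_center]
  have h : (renormMap z a)^[i] x = (renormMap z a)^[j] x := h
  have := e i
  rw [h, e j] at this
  exact (pow_right_injective₀ ratio_pos ratio_lt_one.ne
    (mul_right_cancel₀ (dist_ne_zero.2 hx) this)).symm

/-- Infinitely many distinct points cannot all be rotated into a finite set. -/
theorem false_of_rotate_mem_finite {z a x : ℂ} (hx : x ≠ center z a) {F : Set ℂ} (hF : F.Finite)
    (h : ∀ i, ∃ k < 8, z + rot8 ^ k * ((renormMap z a)^[i] x - z) ∈ F) : False := by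
  have hfin : (⋃ k ∈ Finset.range 8, (fun y => z + rot8 ^ (7 * k) * (y - z)) '' F).Finite :=
    Finite.biUnion (Finset.finite_toSet _) fun k _ => hF.image _
  refine infinite_of_injective_forall_mem (renormMap_iterate_injective hx) (fun i => ?_) hfin
  obtain ⟨k, hk, hi⟩ := h i
  simp only [mem_iUnion]
  exact ⟨k, Finset.mem_range.2 hk, _, hi, rotate_rotate_inv _ _ _⟩

theorem finite_iterPart {α : Type*} (f : α →. α) (N : ℕ) (x : α) :
    {y | ∃ n < N, y ∈ iterPart f n x}.Finite := by
  have h : {y | ∃ n < N, y ∈ iterPart f n x} = ⋃ n ∈ Finset.range N, {y | y ∈ iterPart f n x} := by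
    ext; simp
  rw [h]
  exact Finite.biUnion (Finset.finite_toSet _)
    fun n _ => Subsingleton.finite fun _ h _ h' => Part.mem_unique h h'

/-- The forward orbit of the limit point `c` contains, up to rotations, the infinitely many points
`g^i y`, and its backward orbit the points `g^i x`, where `y` is the image and `x` the preimage
of `c`. -/
theorem isAperiodicPoint_center {z a : ℂ} (ha : a ≠ 0) :
    IsAperiodicPoint (outerBilliard (octagon z a)) (center z a) := by
  set c := center z a with hc
  set T := outerBilliard (octagon z a) with hT
  obtain ⟨x, y, hx, hy, hcy, hxc⟩ := exists_reducedMap_center (z := z) ha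
  have fwd : ∀ i, ∃ n, ∃ k < 8, z + rot8 ^ k * ((renormMap z a)^[i] y - z) ∈ iterPart T n c := by
    intro i
    obtain ⟨n, -, h⟩ := exists_iterPart_renormMap_iterate ha hcy i
    rw [renormMap_iterate_center] at h
    exact ⟨n, exists_iterPart_outerBilliard ha h⟩
  have bwd : ∀ i, ∃ n, ∃ k < 8, c ∈ iterPart T n (z + rot8 ^ k * ((renormMap z a)^[i] x - z)) := by
    intro i
    obtain ⟨n, -, h⟩ := exists_iterPart_renormMap_iterate ha hxc i
    rw [renormMap_iterate_center] at h
    obtain ⟨k, -, h⟩ := exists_iterPart_outerBilliard ha h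
    have h := iterPart_outerBilliard_rotate (7 * k) h
    rw [rotate_rotate_inv] at h
    refine ⟨n, 7 * k % 8, Nat.mod_lt _ (by norm_num), ?_⟩
    rwa [← Nat.div_add_mod (7 * k) 8, pow_add, pow_mul, rot8_pow_eight, one_pow, one_mul] at h
  refine ⟨?_, ?_⟩
  · rintro ⟨p, hp, hper⟩
    -- the orbit of a periodic point is finite
    have red : ∀ n v, v ∈ iterPart T n c → ∃ m < p, v ∈ iterPart T m c := by
      intro n
      induction n using Nat.strong_induction_on with
      | _ n ih =>
        intro v hv
        rcases lt_or_ge n p with h | h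
        · exact ⟨n, h, hv⟩
        · obtain ⟨m, rfl⟩ := Nat.exists_eq_add_of_le h
          obtain ⟨u, hu, hv⟩ := mem_iterPart_add.1 hv
          obtain rfl := Part.mem_unique hu hper
          exact ih m (by omega) v hv
    refine false_of_rotate_mem_finite hy (finite_iterPart T p c) fun i => ?_
    obtain ⟨n, k, hk, h⟩ := fwd i
    exact ⟨k, hk, red n _ h⟩
  · have F : ∀ n, ∃ v, v ∈ iterPart T n c := by
      by_contra! hN
      obtain ⟨N, hN⟩ := hN
      refine false_of_rotate_mem_finite hy (finite_iterPart T N c) fun i => ?_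
      obtain ⟨n, k, hk, h⟩ := fwd i
      refine ⟨k, hk, n, ?_, h⟩
      by_contra! hn
      obtain ⟨m, rfl⟩ := Nat.exists_eq_add_of_le hn
      obtain ⟨u, hu, -⟩ := mem_iterPart_add.1 h
      exact hN u hu
    have B : ∀ n, ∃ v, c ∈ iterPart T n v := by
      by_contra! hN
      obtain ⟨N, hN⟩ := hN
      have hfin : {v | ∃ n < N, c ∈ iterPart T n v}.Finite := by
        have h : {v | ∃ n < N, c ∈ iterPart T n v} =
            ⋃ n ∈ Finset.range N, {v | c ∈ iterPart T n v} := by ext; simp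
        rw [h]
        exact Finite.biUnion (Finset.finite_toSet _)
          fun n _ => Subsingleton.finite fun _ h _ h' => iterPart_outerBilliard_injective h h'
      refine false_of_rotate_mem_finite hx hfin fun i => ?_
      obtain ⟨n, k, hk, h⟩ := bwd i
      refine ⟨k, hk, n, ?_, h⟩
      by_contra! hn
      obtain ⟨m, rfl⟩ := Nat.exists_eq_add_of_le hn
      rw [add_comm] at h
      obtain ⟨u, -, hu⟩ := mem_iterPart_add.1 h
      exact hN u hu
    -- by injectivity the chosen preimages of all orders form one backward orbit
    choose f hf using F
    choose b hb using B
    have b0 : b 0 = c := (mem_iterPart_zero.1 (hb 0)).symm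
    refine ⟨fun n => match n with
      | .ofNat n => f n
      | .negSucc n => b (n + 1), mem_iterPart_zero.1 (hf 0), ?_⟩
    have bstep : ∀ n, b n ∈ T (b (n + 1)) := by
      intro n
      obtain ⟨u, hu, h⟩ := mem_iterPart_succ.1 (hb (n + 1))
      rwa [iterPart_outerBilliard_injective (hb n) h]
    intro n
    match n with
    | .ofNat n =>
      obtain ⟨u, hu, h⟩ := mem_iterPart_succ'.1 (hf (n + 1))
      change f (n + 1) ∈ T (f n)
      rwa [Part.mem_unique (hf n) hu]
    | .negSucc 0 =>
      have e : f 0 = b 0 := by rw [b0]; exact mem_iterPart_zero.1 (hf 0)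
      change f 0 ∈ T (b 1)
      rw [e]; exact bstep 0
    | .negSucc (n + 1) => exact bstep (n + 1)

end OctagonBilliard

/-- Outside every regular octagon (centre `z`, a vertex `z + a`) the outer billiard has an
aperiodic point `c`, which is the limit of a nested sequence of quadrilaterals produced by a
renormalization of the reduced map. -/
theorem mainTheorem1 (z a : ℂ) (ha : a ≠ 0) :
    ∃ (g : ℂ →ᵃ[ℝ] ℂ) (c : ℂ),
      IsRenormalization z a g ∧
      Antitone (renormQuad z a g) ∧
      (⋂ i, renormQuad z a g i) = {c} ∧
      (∀ x : ℕ → ℂ, (∀ i, x i ∈ renormQuad z a g i) → Tendsto x atTop (𝓝 c)) ∧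
      IsAperiodicPoint (outerBilliard (octagon z a)) c :=
  ⟨OctagonBilliard.renormMap z a, OctagonBilliard.center z a,
    OctagonBilliard.isRenormalization_renormMap ha, OctagonBilliard.antitone_renormQuad z a,
    OctagonBilliard.iInter_renormQuad z a,
    fun _ hx => OctagonBilliard.tendsto_of_mem_renormQuad hx,
    OctagonBilliard.isAperiodicPoint_center ha⟩
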